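/- Let $\pi=(\pi_n)_{n\ge1}$ be a sequence of finite partitions $\pi_n=(0=t^n_0<t^n_1<\dots<t^n_{k_n})$ of $[0,\infty)$ with $t^n_{k_n}\to\infty$ and, for every $T>0$, $\max_{i<k_n}\big(t^n_{i+1}\wedge T-t^n_i\wedge T\big)\to0$ as $n\to\infty$. For a càdlàg function $y$ on $[0,\infty)$ write $\Delta y(t)=y(t)-y(t-)$, with $y(0-)=y(0)$. A càdlàg function $y:[0,\infty)\to\mathbb{R}$ has finite quadratic variation $[y]_\pi$ along $\pi$ (in Föllmer's sense) if the measures $$\mu_n=\sum_{i<k_n}\big(y(t^n_{i+1})-y(t^n_i)\big)^2\,\delta_{t^n_i}$$ converge vaguely on $[0,\infty)$ to a Radon measure $\mu$ such that, with $[y]_\pi(t)=\mu([0,t])$, the sums $\sum_{s\le t}(\Delta y(s))^2$ are finite and $t\mapsto[y]_\pi(t)-\sum_{s\le t}(\Delta y(s))^2$ is a continuous increasing function which vanishes at $0$. Let $m\ge 0$ and let $\mathbf{x}=(x^1,\dots,x^m)^T:[0,\infty)\to\mathbb{R}^m$ be càdlàg. Put $$\mathbf{q}_n(t)=\sum_{i<k_n,\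 t^n_i\le t}\big(\mathbf{x}(t^n_{i+1})-\mathbf{x}(t^n_i)\big)\big(\mathbf{x}(t^n_{i+1})-\mathbf{x}(t^n_i)\big)^T .$$ **Theorem 3.6.** The following are equivalent: 1. (Föllmer) all $x^i$ and all $x^i+x^j$ $(1\le i,j\le m)$ have finite quadratic variation along $\pi$; 2. the sequence $(\mathbf{q}_n)$ converges in $D([0,\infty),\mathbb{R}^{m\times m})$ for the Skorokhod $J_1$ topology, i.e. there are a càdlàg $Q:[0,\infty)\to\mathbb{R}^{m\times m}$ and increasing bijections $\lambda_n$ of $[0,\infty)$ such that $\sup_{s\ge0}|\lambda_n(s)-s|\to0$ and $\sup_{s\le N}\|\mathbf{q}_n(\lambda_n(s))-Q(s)\|\to0$ for every $N$. Moreover both definitions yield the same quadratic variation: for every $Q:[0,\infty)\to\mathbb{R}^{m\times m}$, $\mathbf{q}_n\to Q$ in this sense if and only if 1. holds and $Q=\big([x^i,x^j]_\pi\big)_{1\le i,j\le m}$, where $$[x^i,x^j]_\pi(t)=\tfrac12\Big([x^i+x^j]_\pi(t)-[x^i]_\pi(t)-[x^j]_\pi(t)\Big).$$ -/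

import Mathlib

open MeasureTheory Filter Topology
open scoped NNReal

namespace PathwiseQV

/-- A finite partition `0 = t 0 < t 1 < ... < t k` of the time axis `[0, ∞)`. -/
structure TimePartition where
  k : ℕ
  t : Fin (k + 1) → ℝ≥0
  strictMono : StrictMono t
  zero : t 0 = 0

/-- The mesh of the partition on the compact interval `[0, T]`. -/
noncomputable def TimePartition.mesh (p : TimePartition) (T : ℝ≥0) : ℝ≥0 :=
  Finset.univ.sup fun i : Fin p.k => min (p.t i.succ) T - min (p.t i.castSucc) T

/-- The last partition points tend to infinity and the mesh vanishes on compacts. -/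
def IsVanishing (π : ℕ → TimePartition) : Prop :=
  Tendsto (fun n => (π n).t (Fin.last (π n).k)) atTop atTop ∧
    ∀ T : ℝ≥0, Tendsto (fun n => (π n).mesh T) atTop (𝓝 0)

/-- Càdlàg paths on `[0, ∞)`: right-continuous with left limits (the second condition is void at
`t = 0`, where `𝓝[<] t = ⊥`). -/
def IsCadlag {E : Type*} [TopologicalSpace E] (x : ℝ≥0 → E) : Prop :=
  ∀ t : ℝ≥0, ContinuousWithinAt x (Set.Ici t) t ∧ ∃ l : E, Tendsto x (𝓝[<] t) (𝓝 l)

/-- Convergence in the Skorokhod `J₁` topology of `D([0, ∞), E)`: there are increasing bijections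
`l n` of `[0, ∞)` that converge to the identity uniformly on `[0, ∞)`, such that `f n ∘ l n`
converges to `g` uniformly on every `[0, N]`. -/
def J1Tendsto {E : Type*} [UniformSpace E] (f : ℕ → ℝ≥0 → E) (g : ℝ≥0 → E) : Prop :=
  ∃ l : ℕ → (ℝ≥0 ≃o ℝ≥0),
    TendstoUniformly (fun n s => l n s) (fun s => s) atTop ∧
      ∀ N : ℝ≥0, TendstoUniformlyOn (fun n s => f n (l n s)) g atTop (Set.Iic N)

/-- The jump `Δx(t) = x(t) - x(t-)`; it is `0` at `t = 0`, where `x(0-) = x(0)`. -/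
noncomputable def jump (x : ℝ≥0 → ℝ) (t : ℝ≥0) : ℝ :=
  x t - Function.leftLim x t

/-- The discrete measure `∑ i, (x(t (i+1)) - x(t i))² δ_(t i)` along a partition. -/
noncomputable def sqMeasure (p : TimePartition) (x : ℝ≥0 → ℝ) : Measure ℝ≥0 :=
  ∑ i : Fin p.k,
    ENNReal.ofReal ((x (p.t i.succ) - x (p.t i.castSucc)) ^ 2) • Measure.dirac (p.t i.castSucc)

/-- Vague convergence of measures on `[0, ∞)`. -/
def VagueTendsto (ν : ℕ → Measure ℝ≥0) (μ : Measure ℝ≥0) : Prop :=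
  ∀ f : ℝ≥0 → ℝ, Continuous f → HasCompactSupport f →
    Tendsto (fun n => ∫ s, f s ∂(ν n)) atTop (𝓝 (∫ s, f s ∂μ))

/-- Föllmer's definition for a real-valued path: `x` has finite quadratic variation along `π`,
equal to the function `q`. The discrete measures converge vaguely to a Radon measure `μ` with
`q t = μ [0, t]`, and `q t - ∑_{s ≤ t} (Δx(s))²` is a continuous increasing function null at `0`. -/
def IsFollmerQV (π : ℕ → TimePartition) (x q : ℝ≥0 → ℝ) : Prop :=
  ∃ μ : Measure ℝ≥0, μ.Regular ∧ VagueTendsto (fun n => sqMeasure (π n) x) μ ∧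
    (∀ t, q t = μ.real (Set.Iic t)) ∧
    (∀ t : ℝ≥0, Summable fun s : Set.Iic t => jump x s ^ 2) ∧
    Continuous (fun t : ℝ≥0 => q t - ∑' s : Set.Iic t, jump x s ^ 2) ∧
    Monotone (fun t : ℝ≥0 => q t - ∑' s : Set.Iic t, jump x s ^ 2) ∧
    q 0 - ∑' s : Set.Iic (0 : ℝ≥0), jump x s ^ 2 = 0

/-- A real-valued path has finite quadratic variation along `π` in Föllmer's sense. -/
def HasFollmerQV (π : ℕ → TimePartition) (x : ℝ≥0 → ℝ) : Prop :=
  ∃ q : ℝ≥0 → ℝ, IsFollmerQV π x q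

/-- Föllmer's componentwise definition for a vector-valued path: all `xⁱ` and all `xⁱ + xʲ` have
finite quadratic variation. -/
def HasVectorFollmerQV {m : ℕ} (π : ℕ → TimePartition) (x : ℝ≥0 → Fin m → ℝ) : Prop :=
  (∀ i, HasFollmerQV π fun t => x t i) ∧ ∀ i j, HasFollmerQV π fun t => x t i + x t j

/-- `x` has finite quadratic variation in Föllmer's componentwise sense, and `Q` is the matrix of
covariations `[xⁱ, xʲ] = ([xⁱ + xʲ] - [xⁱ] - [xʲ]) / 2`. -/
def IsVectorFollmerQV {m : ℕ} (π : ℕ → TimePartition) (x : ℝ≥0 → Fin m → ℝ)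
    (Q : ℝ≥0 → Matrix (Fin m) (Fin m) ℝ) : Prop :=
  ∃ (q : Fin m → ℝ≥0 → ℝ) (r : Fin m → Fin m → ℝ≥0 → ℝ),
    (∀ i, IsFollmerQV π (fun t => x t i) (q i)) ∧
    (∀ i j, IsFollmerQV π (fun t => x t i + x t j) (r i j)) ∧
    ∀ t i j, Q t i j = (r i j t - q i t - q j t) / 2

/-- The matrix sums
`q(t) = ∑_{t i ≤ t} (x(t (i+1)) - x(t i)) (x(t (i+1)) - x(t i))ᵀ` along a partition. -/
noncomputable def matrixSum {m : ℕ} (p : TimePartition) (x : ℝ≥0 → Fin m → ℝ) (t : ℝ≥0) :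
    Matrix (Fin m) (Fin m) ℝ :=
  ∑ i : Fin p.k with p.t i.castSucc ≤ t,
    Matrix.vecMulVec (x (p.t i.succ) - x (p.t i.castSucc)) (x (p.t i.succ) - x (p.t i.castSucc))

/-- `x` has finite quadratic variation `Q` along `π` in the Skorokhod sense: the matrix sums
converge to `Q` in `D([0, ∞), ℝ^(m × m))` with the `J₁` topology. -/
def IsSkorokhodQV {m : ℕ} (π : ℕ → TimePartition) (x : ℝ≥0 → Fin m → ℝ)
    (Q : ℝ≥0 → Matrix (Fin m) (Fin m) ℝ) : Prop :=
  IsCadlag Q ∧ J1Tendsto (fun n => matrixSum (π n) x) Q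

/-- The matrix sums have a limit in `D([0, ∞), ℝ^(m × m))` with the `J₁` topology. -/
def HasSkorokhodQV {m : ℕ} (π : ℕ → TimePartition) (x : ℝ≥0 → Fin m → ℝ) : Prop :=
  ∃ Q : ℝ≥0 → Matrix (Fin m) (Fin m) ℝ, IsSkorokhodQV π x Q

end PathwiseQV

open PathwiseQV

/-! For a scalar path `y`, Föllmer's condition reduces to two facts about a locally finite measure
`μ`: the discrete distribution functions `F_n` converge to `F(t) = μ [0, t]` in the interlaced sense
of `CdfTendsto`, which is equivalent to vague convergence (`VagueTendsto.cdfTendsto`,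
`CdfTendsto.vagueTendsto`), and every atom of `μ` equals the squared jump of `y` there
(`IsFollmerQV.exists_measure`, `isFollmerQV_of_cdfTendsto`).

From Föllmer to Skorokhod: for `u > 0` the partition interval `(v_n, w_n]` containing `u` carries a
squared increment converging to `(Δy(u))² = μ {u}`. So a single atom of the discrete measure, at
`v_n`, accounts for the whole jump of `F` at `u`, and both `F_n(v_n)` and `F_n(v_n-)` converge to
`F(u)` and `F(u-)` (`CdfTendsto.tendsto_real_partition`). A time change moving finitely many `u` to
their `v_n` then gives uniform closeness, by monotonicity between grid points
(`eventually_exists_timeChange`). Since `v_n` depends on the partition only, one time change serves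
all `x^i` and `x^i + x^j`, and polarization yields matrix convergence.

From Skorokhod to Föllmer: the diagonal entries, and their combinations by polarization, give
increasing limits, hence Stieltjes measures. Time changes tending to the identity give `CdfTendsto`.
Uniform convergence prevents several discrete atoms from merging into one limit atom, which
identifies the atoms with the squared jumps (`real_singleton_eq_sq_jump`).

Both directions keep the same `Q`, so the two notions agree in existence and in value. -/

namespace PathwiseQV

open Set

/-! ### Distribution functions of locally finite measures on the half-line. -/

section Measure

variable (ν : Measure ℝ≥0) [IsFiniteMeasureOnCompacts ν]

lemma measure_Iic_ne_top (t : ℝ≥0) : ν (Iic t) ≠ ⊤ := by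
  have h : Iic t = Icc 0 t := by ext; simp
  rw [h]
  exact isCompact_Icc.measure_ne_top

lemma measure_ne_top_of_subset_Iic {s : Set ℝ≥0} {t : ℝ≥0} (h : s ⊆ Iic t) : ν s ≠ ⊤ :=
  measure_ne_top_of_subset h (measure_Iic_ne_top ν t)

lemma monotone_real_Iic : Monotone fun t => ν.real (Iic t) := fun _ b hab =>
  measureReal_mono (Iic_subset_Iic.2 hab) (measure_Iic_ne_top ν b)

lemma real_Iic_le_real_Iio {a b : ℝ≥0} (h : a < b) : ν.real (Iic a) ≤ ν.real (Iio b) :=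
  measureReal_mono (Iic_subset_Iio.2 h) (measure_ne_top_of_subset_Iic ν Iio_subset_Iic_self)

lemma real_Iic_eq_real_Iio_add (t : ℝ≥0) : ν.real (Iic t) = ν.real (Iio t) + ν.real {t} := by
  rw [← measureReal_union (by simp) (measurableSet_singleton t)
    (measure_ne_top_of_subset_Iic ν Iio_subset_Iic_self)
    (measure_ne_top_of_subset_Iic ν (t := t) (by simp))]
  congr 1
  ext s
  simp [le_iff_lt_or_eq]

lemma real_Iio_eq_real_Iic_add {a b : ℝ≥0} (h : a < b) :
    ν.real (Iio b) = ν.real (Iic a) + ν.real (Ioo a b) := by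
  rw [← measureReal_union _ measurableSet_Ioo (measure_Iic_ne_top ν a)
    (measure_ne_top_of_subset_Iic ν (t := b) fun x hx => hx.2.le), Iic_union_Ioo_eq_Iio h]
  exact disjoint_left.2 fun x hx hx' => not_lt.2 hx hx'.1

/-- Dominated convergence for indicators, with `Iic t` as the dominating set; it covers continuity
from below and from above at once. -/
lemma tendsto_real_of_eventually_mem_iff {ι : Type*} {l : Filter ι} [l.IsCountablyGenerated]
    {A : Set ℝ≥0} {As : ι → Set ℝ≥0} (hAs : ∀ i, MeasurableSet (As i))
    {t : ℝ≥0} (hle : ∀ᶠ i in l, As i ⊆ Iic t) (hlim : ∀ x, ∀ᶠ i in l, x ∈ As i ↔ x ∈ A) :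
    Tendsto (fun i => ν.real (As i)) l (𝓝 (ν.real A)) := by
  rcases l.eq_or_neBot with rfl | hl
  · exact tendsto_bot
  refine (ENNReal.tendsto_toReal ?_).comp
    (tendsto_measure_of_tendsto_indicator l hAs measurableSet_Iic (measure_Iic_ne_top ν t)
      hle hlim)
  refine measure_ne_top_of_subset_Iic ν (t := t) fun x hx => ?_
  obtain ⟨i, hi, hi'⟩ := (hle.and (hlim x)).exists
  exact hi (hi'.2 hx)

lemma tendsto_real_Iic_left (u : ℝ≥0) :
    Tendsto (fun s => ν.real (Iic s)) (𝓝[<] u) (𝓝 (ν.real (Iio u))) := by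
  refine tendsto_real_of_eventually_mem_iff ν (fun _ => measurableSet_Iic)
    (t := u) ?_ fun x => ?_
  · filter_upwards [self_mem_nhdsWithin] with s hs
    exact Iic_subset_Iic.2 (le_of_lt hs)
  · by_cases h : x < u
    · filter_upwards [mem_nhdsWithin_of_mem_nhds (Ici_mem_nhds h)] with s hs
      simpa [h] using hs
    · filter_upwards [self_mem_nhdsWithin] with s hs
      simp only [mem_Iio] at hs
      simpa [h] using hs.trans_le (not_lt.1 h)

lemma continuousWithinAt_real_Iic (u : ℝ≥0) :
    ContinuousWithinAt (fun s => ν.real (Iic s)) (Ici u) u := by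
  refine tendsto_real_of_eventually_mem_iff ν (fun _ => measurableSet_Iic)
    (t := u + 1) ?_ fun x => ?_
  · filter_upwards [mem_nhdsWithin_of_mem_nhds
      (Iic_mem_nhds (lt_add_of_pos_right u zero_lt_one))] with s hs
    exact Iic_subset_Iic.2 hs
  · by_cases h : x ≤ u
    · filter_upwards [self_mem_nhdsWithin] with s hs
      simpa [h] using h.trans hs
    · filter_upwards [mem_nhdsWithin_of_mem_nhds (Iio_mem_nhds (not_le.1 h))] with s hs
      simpa [h] using hs

lemma isCadlag_real_Iic : IsCadlag fun t => ν.real (Iic t) := fun t =>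
  ⟨continuousWithinAt_real_Iic ν t, _, tendsto_real_Iic_left ν t⟩

end Measure

/-! ### One-sided limits of sums of jumps. -/

section JumpSum

variable {g : ℝ≥0 → ℝ}

lemma tendsto_tsum_Iic (hg : 0 ≤ g) {l : Filter ℝ≥0} {t : ℝ≥0}
    (hs : Summable fun s : Iic t => g s) {A : Set ℝ≥0} (hle : ∀ᶠ u in l, u ≤ t)
    (hlim : ∀ x, ∀ᶠ u in l, x ∈ Iic u ↔ x ∈ A) :
    Tendsto (fun u : ℝ≥0 => ∑' s : Iic u, g s) l (𝓝 (∑' s : A, g s)) := by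
  simp only [tsum_subtype]
  refine tendsto_tsum_of_dominated_convergence (summable_subtype_iff_indicator.1 hs)
    (fun x => ?_) ?_
  · refine tendsto_const_nhds.congr' ?_
    filter_upwards [hlim x] with u hu
    by_cases hx : x ∈ A
    · rw [indicator_of_mem hx, indicator_of_mem (hu.2 hx)]
    · rw [indicator_of_notMem hx, indicator_of_notMem (fun h => hx (hu.1 h))]
  · filter_upwards [hle] with u hu x
    rw [Real.norm_of_nonneg (indicator_nonneg (fun x _ => hg x) x)]
    exact indicator_le_indicator_of_subset (Iic_subset_Iic.2 hu) (fun x => hg x) x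

lemma tendsto_tsum_Iic_left (hg : 0 ≤ g) {t : ℝ≥0} (hs : Summable fun s : Iic t => g s) :
    Tendsto (fun u : ℝ≥0 => ∑' s : Iic u, g s) (𝓝[<] t) (𝓝 (∑' s : Iic t, g s - g t)) := by
  have h : ∑' s : Iio t, g s = ∑' s : Iic t, g s - g t := by
    have hs' := summable_subtype_iff_indicator.1 hs
    rw [tsum_subtype, tsum_subtype, hs'.tsum_eq_add_tsum_ite t]
    simp only [mem_Iic, le_refl, indicator_of_mem, add_sub_cancel_left]
    refine tsum_congr fun x => ?_
    by_cases hx : x = t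
    · simp [hx]
    · simp [hx, indicator, le_iff_lt_or_eq]
  rw [← h]
  refine tendsto_tsum_Iic hg hs ?_ fun x => ?_
  · filter_upwards [self_mem_nhdsWithin] with s hs using le_of_lt hs
  · by_cases h : x < t
    · filter_upwards [mem_nhdsWithin_of_mem_nhds (Ici_mem_nhds h)] with s hs
      simpa [h] using hs
    · filter_upwards [self_mem_nhdsWithin] with s hs
      simp only [mem_Iio] at hs
      simpa [h] using hs.trans_le (not_lt.1 h)

lemma continuousWithinAt_tsum_Iic (hg : 0 ≤ g) (hs : ∀ t : ℝ≥0, Summable fun s : Iic t => g s)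
    (t : ℝ≥0) : ContinuousWithinAt (fun u : ℝ≥0 => ∑' s : Iic u, g s) (Ici t) t := by
  refine tendsto_tsum_Iic hg (hs (t + 1)) ?_ fun x => ?_
  · filter_upwards [mem_nhdsWithin_of_mem_nhds
      (Iic_mem_nhds (lt_add_of_pos_right t zero_lt_one))] with s hs using hs
  · by_cases h : x ≤ t
    · filter_upwards [self_mem_nhdsWithin] with s hs
      simpa [h] using h.trans hs
    · filter_upwards [mem_nhdsWithin_of_mem_nhds (Iio_mem_nhds (not_le.1 h))] with s hs
      simpa [h] using hs

lemma tsum_Iic_zero : ∑' s : Iic (0 : ℝ≥0), g s = g 0 := by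
  have h : Iic (0 : ℝ≥0) = {0} := by ext; simp
  rw [h, tsum_singleton]

lemma continuousAt_of_left_right {f : ℝ≥0 → ℝ} {t : ℝ≥0} (hl : Tendsto f (𝓝[<] t) (𝓝 (f t)))
    (hr : ContinuousWithinAt f (Ici t) t) : ContinuousAt f t := by
  rw [continuousAt_iff_continuous_left'_right']
  exact ⟨hl, hr.mono Ioi_subset_Ici_self⟩

end JumpSum

/-! ### Splitting a measure into atoms and a continuous remainder. -/

section AtomicPart

variable (ν : Measure ℝ≥0) [IsFiniteMeasureOnCompacts ν]

lemma sum_real_singleton_le {a b : ℝ≥0} (hab : a ≤ b) (S : Finset ℝ≥0) (hS : ∀ s ∈ S, s ∈ Ioc a b) :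
    ∑ s ∈ S, ν.real {s} ≤ ν.real (Iic b) - ν.real (Iic a) := by
  have h1 : ∑ s ∈ S, ν.real {s} = ν.real (S : Set ℝ≥0) :=
    sum_measureReal_singleton S
  have h2 : ν.real (Iic b) = ν.real (Iic a) + ν.real (Ioc a b) := by
    rw [← measureReal_union (Iic_disjoint_Ioc le_rfl) measurableSet_Ioc (measure_Iic_ne_top ν a)
      (measure_ne_top_of_subset_Iic ν (t := b) fun x hx => hx.2), Iic_union_Ioc_eq_Iic hab]
  rw [h1, h2, add_sub_cancel_left]
  exact measureReal_mono hS (measure_ne_top_of_subset_Iic ν (t := b) fun x hx => hx.2)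

lemma summable_real_singleton (t : ℝ≥0) : Summable fun s : Iic t => ν.real {(s : ℝ≥0)} := by
  refine summable_of_sum_le (c := ν.real (Iic t)) (fun _ => measureReal_nonneg) fun S => ?_
  refine (Finset.sum_map S (Function.Embedding.subtype _) (fun s => ν.real {s})).symm.trans_le ?_
  rw [sum_measureReal_singleton]
  refine measureReal_mono (fun s hs => ?_) (measure_Iic_ne_top ν t)
  simp only [Finset.coe_map, mem_image] at hs
  obtain ⟨x, -, rfl⟩ := hs
  exact x.2

lemma continuous_real_Iic_sub_tsum :
    Continuous fun t : ℝ≥0 => ν.real (Iic t) - ∑' s : Iic t, ν.real {(s : ℝ≥0)} := by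
  have hg : (0 : ℝ≥0 → ℝ) ≤ fun s => ν.real {s} := fun _ => measureReal_nonneg
  refine continuous_iff_continuousAt.2 fun t => continuousAt_of_left_right ?_ ?_
  · convert (tendsto_real_Iic_left ν t).sub
      (tendsto_tsum_Iic_left hg (summable_real_singleton ν t)) using 2
    rw [real_Iic_eq_real_Iio_add]
    ring
  · exact (continuousWithinAt_real_Iic ν t).sub
      (continuousWithinAt_tsum_Iic hg (summable_real_singleton ν) t)

/-- The increment over `(a, b]` is the mass of `(a, b]` minus the total mass of its atoms, and
finitely many atoms never exceed the whole. -/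
lemma monotone_real_Iic_sub_tsum :
    Monotone fun t : ℝ≥0 => ν.real (Iic t) - ∑' s : Iic t, ν.real {(s : ℝ≥0)} := by
  intro a b hab
  have hsum : ∀ t : ℝ≥0, Summable ((Iic t).indicator fun s => ν.real {s}) := fun t =>
    summable_subtype_iff_indicator.1 (summable_real_singleton ν t)
  have key : ∑' s : Iic b, ν.real {(s : ℝ≥0)} - ∑' s : Iic a, ν.real {(s : ℝ≥0)} ≤
      ν.real (Iic b) - ν.real (Iic a) := by
    rw [tsum_subtype (Iic b) (fun s => ν.real {s}), tsum_subtype (Iic a) (fun s => ν.real {s}),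
      ← (hsum b).tsum_sub (hsum a)]
    refine ((hsum b).sub (hsum a)).tsum_le_of_sum_le fun S => ?_
    refine le_trans (le_of_eq ?_)
      (sum_real_singleton_le ν hab (S.filter (· ∈ Ioc a b)) (by simp))
    rw [Finset.sum_filter]
    refine Finset.sum_congr rfl fun s _ => ?_
    by_cases h1 : s ≤ a
    · simp [h1, h1.trans hab, not_lt.2 h1]
    · by_cases h2 : s ≤ b <;> simp [h1, h2, not_le.1 h1]
  simp only
  linarith

/-- Comparing the value at `t` with the left limit, the distribution function jumps by the atom and
the sum by `g t`; continuity makes these equal. The argument needs a left neighbourhood, hence `0 <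
t`. -/
lemma real_singleton_eq_of_continuous {g : ℝ≥0 → ℝ} (hg : 0 ≤ g)
    (hs : ∀ t : ℝ≥0, Summable fun s : Iic t => g s)
    (hc : Continuous fun t : ℝ≥0 => ν.real (Iic t) - ∑' s : Iic t, g s) {t : ℝ≥0} (ht : 0 < t) :
    ν.real {t} = g t := by
  have : (𝓝[<] t).NeBot := nhdsLT_neBot_of_exists_lt ⟨0, ht⟩
  have h1 := (hc.tendsto t).mono_left (nhdsWithin_le_nhds (s := Iio t))
  have h2 := (tendsto_real_Iic_left ν t).sub (tendsto_tsum_Iic_left hg (hs t))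
  have h3 := tendsto_nhds_unique h1 h2
  have h4 := real_Iic_eq_real_Iio_add ν t
  linarith

end AtomicPart

/-! ### Partition intervals under vanishing mesh. -/

section Partition

variable {π : ℕ → TimePartition}

lemma TimePartition.castSucc_lt_succ (p : TimePartition) (i : Fin p.k) :
    p.t i.castSucc < p.t i.succ := p.strictMono i.castSucc_lt_succ

lemma TimePartition.min_succ_le (p : TimePartition) (T : ℝ≥0) (i : Fin p.k) :
    min (p.t i.succ) T ≤ min (p.t i.castSucc) T + p.mesh T := by
  have h : min (p.t i.succ) T - min (p.t i.castSucc) T ≤ p.mesh T :=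
    Finset.le_sup (f := fun i : Fin p.k => min (p.t i.succ) T - min (p.t i.castSucc) T)
      (Finset.mem_univ i)
  rw [add_comm]
  exact tsub_le_iff_right.1 h

/-- Once the mesh on `[0, b]` is below `b - a`, no interval can start at or before `a` and reach
`b`. This is how the mesh condition enters the later arguments. -/
lemma IsVanishing.eventually_succ_lt (hπ : IsVanishing π) {a b : ℝ≥0} (hab : a < b) :
    ∀ᶠ n in atTop, ∀ i : Fin (π n).k, (π n).t i.castSucc ≤ a → (π n).t i.succ < b := by
  filter_upwards [(hπ.2 b).eventually (gt_mem_nhds (tsub_pos_of_lt hab))] with n hn i hi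
  have h1 := (π n).min_succ_le b i
  rw [min_eq_left (hi.trans hab.le)] at h1
  have h2 : min ((π n).t i.succ) b < b := by
    refine h1.trans_lt ?_
    calc (π n).t i.castSucc + (π n).mesh b < a + (b - a) := add_lt_add_of_le_of_lt hi hn
      _ = b := add_tsub_cancel_of_le hab.le
  exact (min_lt_iff.1 h2).resolve_right (lt_irrefl b)

lemma TimePartition.exists_mem_Ioc (p : TimePartition) {u : ℝ≥0} (hu : 0 < u)
    (hlast : u ≤ p.t (Fin.last p.k)) :
    ∃ i : Fin p.k, p.t i.castSucc < u ∧ u ≤ p.t i.succ := by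
  classical
  have hne : (Finset.univ.filter fun j : Fin (p.k + 1) => p.t j < u).Nonempty :=
    ⟨0, by simpa [p.zero] using hu⟩
  obtain ⟨j, hj, hmax⟩ := Finset.exists_max_image _ id hne
  simp only [Finset.mem_filter, Finset.mem_univ, true_and, id] at hj hmax
  have hjl : j ≠ Fin.last p.k := by
    rintro rfl
    exact absurd hj (not_lt.2 hlast)
  obtain ⟨i, rfl⟩ := Fin.exists_castSucc_eq.2 hjl
  refine ⟨i, hj, not_lt.1 fun h => ?_⟩
  exact absurd (hmax _ h) (not_le.2 i.castSucc_lt_succ)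

end Partition

/-! ### Local oscillation of càdlàg paths. -/

section Jumps

variable {y : ℝ≥0 → ℝ}

lemma IsCadlag.tendsto_leftLim (hy : IsCadlag y) (u : ℝ≥0) :
    Tendsto y (𝓝[<] u) (𝓝 (Function.leftLim y u)) :=
  tendsto_leftLim_of_tendsto (hy u).2

lemma jump_zero (y : ℝ≥0 → ℝ) : jump y 0 = 0 := by
  rw [jump, leftLim_eq_of_isBot fun _ => zero_le, sub_self]

/-- Near `u`, a càdlàg path has increments close to `0` on either side of `u`, and close to the
jump at `u` across `u`. -/
lemma IsCadlag.exists_nhds_increment (hy : IsCadlag y) (u : ℝ≥0) {ε : ℝ} (hε : 0 < ε) :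
    ∃ W ∈ 𝓝 u, ∀ a ∈ W, ∀ b ∈ W, a ≤ b →
      ((a < u ∧ u ≤ b) ∨ |y b - y a| < ε) ∧
      (a < u → u ≤ b → |y b - y a - jump y u| < ε) := by
  have hl := (hy.tendsto_leftLim u).eventually (Metric.ball_mem_nhds _ (half_pos hε))
  have hr := (hy u).1.eventually (Metric.ball_mem_nhds _ (half_pos hε))
  refine ⟨_, inter_mem (mem_nhdsWithin_iff_eventually.1 hl)
    (mem_nhdsWithin_iff_eventually.1 hr), ?_⟩
  rintro a ⟨ha, ha'⟩ b ⟨hb, hb'⟩ hab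
  simp only [mem_ofPred_eq, Real.dist_eq, abs_lt, mem_Iio, mem_Ici] at ha ha' hb hb'
  refine ⟨?_, fun hau hbu => ?_⟩
  · rcases lt_or_ge b u with hbu | hbu
    · have h1 := ha (hab.trans_lt hbu)
      have h2 := hb hbu
      right
      rw [abs_lt]
      constructor <;> linarith
    · rcases lt_or_ge a u with hau | hau
      · exact Or.inl ⟨hau, hbu⟩
      · have h1 := ha' hau
        have h2 := hb' hbu
        right
        rw [abs_lt]
        constructor <;> linarith
  · have h1 := ha hau
    have h2 := hb' hbu
    rw [abs_lt, jump]
    constructor <;> linarith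

lemma IsCadlag.exists_nhds_sq_increment (hy : IsCadlag y) (u : ℝ≥0) {ε : ℝ} (hε : 0 < ε) :
    ∃ W ∈ 𝓝 u, (∀ a ∈ W, ∀ b ∈ W, a ≤ b → (y b - y a) ^ 2 < jump y u ^ 2 + ε) ∧
      ∀ a ∈ W, ∀ b ∈ W, a < u → u ≤ b → jump y u ^ 2 - ε < (y b - y a) ^ 2 := by
  have h0 : Tendsto (fun z : ℝ => z ^ 2) (𝓝 0) (𝓝 0) := by
    simpa using (continuous_pow (M := ℝ) 2).tendsto 0
  have hJ := (continuous_pow (M := ℝ) 2).tendsto (jump y u)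
  obtain ⟨δ₁, hδ₁, h₁⟩ := Metric.eventually_nhds_iff.1 (h0.eventually (gt_mem_nhds hε))
  obtain ⟨δ₂, hδ₂, h₂⟩ := Metric.eventually_nhds_iff.1
    (hJ.eventually (Ioo_mem_nhds (sub_lt_self _ hε) (lt_add_of_pos_right _ hε)))
  obtain ⟨W, hW, h⟩ := hy.exists_nhds_increment u (lt_min hδ₁ hδ₂)
  have across : ∀ a ∈ W, ∀ b ∈ W, a < u → u ≤ b →
      (y b - y a) ^ 2 ∈ Ioo (jump y u ^ 2 - ε) (jump y u ^ 2 + ε) := fun a ha b hb hau hub =>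
    h₂ (y := y b - y a) (((h a ha b hb (hau.le.trans hub)).2 hau hub).trans_le (min_le_right _ _))
  refine ⟨W, hW, fun a ha b hb hab => ?_, fun a ha b hb hau hub => (across a ha b hb hau hub).1⟩
  rcases (h a ha b hb hab).1 with ⟨hau, hub⟩ | h'
  · exact (across a ha b hb hau hub).2
  · have := h₁ (y := y b - y a) (by simpa using h'.trans_le (min_le_left _ _))
    nlinarith [sq_nonneg (jump y u)]

end Jumps

/-! ### Atoms of the discrete measures. -/

section SqMeasure

variable (p : TimePartition) (x : ℝ≥0 → ℝ)

instance : IsFiniteMeasure (sqMeasure p x) := by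
  constructor
  rw [sqMeasure, Measure.finsetSum_apply]
  simp [ENNReal.sum_lt_top]

lemma sqMeasure_real {A : Set ℝ≥0} (hA : MeasurableSet A) [DecidablePred (· ∈ A)] :
    (sqMeasure p x).real A = ∑ i : Fin p.k with p.t i.castSucc ∈ A,
      (x (p.t i.succ) - x (p.t i.castSucc)) ^ 2 := by
  rw [Measure.real, sqMeasure, Measure.finsetSum_apply, ENNReal.toReal_sum, Finset.sum_filter]
  · refine Finset.sum_congr rfl fun i _ => ?_
    by_cases h : p.t i.castSucc ∈ A <;> simp [hA, h, sq_nonneg]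
  · intro i _
    by_cases h : p.t i.castSucc ∈ A <;> simp [hA, h]

lemma sqMeasure_real_singleton (i : Fin p.k) :
    (sqMeasure p x).real {p.t i.castSucc} = (x (p.t i.succ) - x (p.t i.castSucc)) ^ 2 := by
  classical
  rw [sqMeasure_real p x (measurableSet_singleton _)]
  have : (Finset.univ.filter fun j : Fin p.k => p.t j.castSucc ∈ ({p.t i.castSucc} : Set ℝ≥0)) =
      {i} := by
    ext j
    simp [p.strictMono.injective.eq_iff]
  rw [this, Finset.sum_singleton]

lemma sqMeasure_real_singleton_of_ne {v : ℝ≥0} (hv : ∀ i : Fin p.k, p.t i.castSucc ≠ v) :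
    (sqMeasure p x).real {v} = 0 := by
  classical
  rw [sqMeasure_real p x (measurableSet_singleton _)]
  refine Finset.sum_eq_zero fun i hi => absurd ?_ (hv i)
  simpa using hi

variable {π : ℕ → TimePartition} {x}

/-- An interval starting near `u` either ends before `u` or ends shortly after it, so its increment
is nearly zero or nearly the jump. No atom close to `u` can therefore exceed the squared jump by
much. -/
lemma IsCadlag.eventually_sqMeasure_singleton_lt (hx : IsCadlag x) (hπ : IsVanishing π)
    {u : ℝ≥0} {v : ℕ → ℝ≥0} (hv : Tendsto v atTop (𝓝 u)) {ε : ℝ} (hε : 0 < ε) :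
    ∀ᶠ n in atTop, (sqMeasure (π n) x).real {v n} < jump x u ^ 2 + ε := by
  obtain ⟨W, hW, h, -⟩ := hx.exists_nhds_sq_increment u hε
  obtain ⟨c, huc, hc⟩ := exists_Ico_subset_of_mem_nhds hW ⟨u + 1, lt_add_one u⟩
  obtain ⟨d, hud, hdc⟩ := exists_between huc
  -- The segment from `v n` to `u` lies in `W`, which handles a right endpoint before `u`; the
  -- intermediate point `d` together with the mesh keeps any other right endpoint below `c`.
  filter_upwards [(hv.Icc (tendsto_const_nhds (x := u))).eventually
    (eventually_smallSets_subset.2 hW), hv.eventually hW, hv.eventually (gt_mem_nhds hud),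
    hπ.eventually_succ_lt hdc] with n h0 h1 h2 h3
  by_cases hi : ∃ i : Fin (π n).k, (π n).t i.castSucc = v n
  · obtain ⟨i, hi⟩ := hi
    rw [← hi, sqMeasure_real_singleton]
    rw [← hi] at h0 h1 h2
    have h4 := (π n).castSucc_lt_succ i
    rcases lt_or_ge ((π n).t i.succ) u with h5 | h5
    · exact h _ h1 _ (h0 ⟨h4.le, h5.le⟩) h4.le
    · exact h _ h1 _ (hc ⟨h5, h3 i h2.le⟩) h4.le
  · push Not at hi
    rw [sqMeasure_real_singleton_of_ne _ _ hi]
    positivity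

end SqMeasure

/-! ### Polarization of the matrix sums. -/

section MatrixSum

variable {m : ℕ} (p : TimePartition) (x : ℝ≥0 → Fin m → ℝ) (t : ℝ≥0) (i j : Fin m)

lemma matrixSum_apply : matrixSum p x t i j = ∑ k : Fin p.k with p.t k.castSucc ≤ t,
    (x (p.t k.succ) i - x (p.t k.castSucc) i) * (x (p.t k.succ) j - x (p.t k.castSucc) j) := by
  rw [matrixSum, Matrix.sum_apply]
  rfl

lemma sqMeasure_real_Iic_coord :
    (sqMeasure p fun s => x s i).real (Iic t) = matrixSum p x t i i := by
  rw [sqMeasure_real _ _ measurableSet_Iic, matrixSum_apply]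
  simp only [mem_Iic, sq]

lemma sqMeasure_real_Iic_add : (sqMeasure p fun s => x s i + x s j).real (Iic t) =
    matrixSum p x t i i + matrixSum p x t j j + 2 * matrixSum p x t i j := by
  rw [sqMeasure_real _ _ measurableSet_Iic]
  simp only [matrixSum_apply, mem_Iic, Finset.mul_sum, ← Finset.sum_add_distrib]
  refine Finset.sum_congr rfl fun k _ => ?_
  ring

end MatrixSum

/-! ### Vague convergence through distribution functions. -/

section Vague

variable {ν : ℕ → Measure ℝ≥0} {μ : Measure ℝ≥0}

/-- Interlaced convergence of distribution functions: asymptotically, `ν n [0, a]` is at most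
`μ [0, b]` and `μ [0, a]` is at most `ν n [0, b]` whenever `a < b`. -/
def CdfTendsto (ν : ℕ → Measure ℝ≥0) (μ : Measure ℝ≥0) : Prop :=
  ∀ a b : ℝ≥0, a < b → ∀ ε : ℝ, 0 < ε → ∀ᶠ n in atTop,
    (ν n).real (Iic a) < μ.real (Iic b) + ε ∧ μ.real (Iic a) - ε < (ν n).real (Iic b)

lemma CdfTendsto.tendsto_real_Iic (h : CdfTendsto ν μ) {t : ℝ≥0} (ht : 0 < t)
    (hc : ContinuousAt (fun s => μ.real (Iic s)) t) :
    Tendsto (fun n => (ν n).real (Iic t)) atTop (𝓝 (μ.real (Iic t))) := by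
  rw [Metric.tendsto_nhds]
  intro ε hε
  have h1 := hc.eventually (Metric.ball_mem_nhds _ (half_pos hε))
  obtain ⟨a, hat, ha⟩ := exists_Ioc_subset_of_mem_nhds h1 ⟨0, ht⟩
  obtain ⟨b, htb, hb⟩ := exists_Ico_subset_of_mem_nhds h1 ⟨t + 1, lt_add_one t⟩
  obtain ⟨a', haa', ha't⟩ := exists_between hat
  obtain ⟨b', htb', hb'b⟩ := exists_between htb
  have hA := ha ⟨haa', ha't.le⟩
  have hB := hb ⟨htb'.le, hb'b⟩
  simp only [mem_ofPred_eq, Real.dist_eq, abs_lt] at hA hB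
  filter_upwards [h a' t ha't _ (half_pos hε), h t b' htb' _ (half_pos hε)] with n hn hn'
  rw [Real.dist_eq, abs_lt]
  constructor <;> linarith [hA.1, hB.2, hn.2, hn'.1]

lemma exists_continuous_between_indicator_Iic {a b : ℝ≥0} (hab : a < b) :
    ∃ f : ℝ≥0 → ℝ, Continuous f ∧ HasCompactSupport f ∧
      (Iic a).indicator 1 ≤ f ∧ f ≤ (Iic b).indicator 1 := by
  have hab' : (0 : ℝ) < b - a := sub_pos.2 (NNReal.coe_lt_coe.2 hab)
  have hz : ∀ s : ℝ≥0, b < s → max 0 (min 1 (((b : ℝ) - s) / (b - a))) = 0 := fun s hs => by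
    refine max_eq_left ((min_le_right _ _).trans (div_nonpos_of_nonpos_of_nonneg ?_ hab'.le))
    exact sub_nonpos.2 (NNReal.coe_le_coe.2 hs.le)
  refine ⟨fun s => max 0 (min 1 (((b : ℝ) - s) / (b - a))), by fun_prop,
    HasCompactSupport.intro (isCompact_Icc (a := 0) (b := b)) fun s hs => hz s ?_,
    fun s => ?_, fun s => ?_⟩
  · simpa using hs
  · by_cases hs : s ≤ a
    · rw [indicator_of_mem (show s ∈ Iic a from hs)]
      refine le_max_of_le_right (le_min le_rfl ?_)
      rw [Pi.one_apply, le_div_iff₀ hab', one_mul]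
      exact sub_le_sub_left (NNReal.coe_le_coe.2 hs) _
    · rw [indicator_of_notMem (show s ∉ Iic a from hs)]
      exact le_max_left _ _
  · by_cases hs : s ≤ b
    · rw [indicator_of_mem (show s ∈ Iic b from hs)]
      exact max_le zero_le_one (min_le_left _ _)
    · rw [indicator_of_notMem (show s ∉ Iic b from hs)]
      exact (hz s (not_le.1 hs)).le

variable [∀ n, IsFiniteMeasureOnCompacts (ν n)] [IsFiniteMeasureOnCompacts μ]

lemma integrable_indicator_Iic_one (b : ℝ≥0) : Integrable ((Iic b).indicator (1 : ℝ≥0 → ℝ)) μ :=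
  IntegrableOn.integrable_indicator
    (integrableOn_const (C := (1 : ℝ)) (measure_Iic_ne_top μ b)) measurableSet_Iic

lemma VagueTendsto.cdfTendsto (h : VagueTendsto ν μ) : CdfTendsto ν μ := by
  intro a b hab ε hε
  obtain ⟨f, hf, hf', hfa, hfb⟩ := exists_continuous_between_indicator_Iic hab
  have bounds : ∀ (ρ : Measure ℝ≥0) [IsFiniteMeasureOnCompacts ρ],
      ρ.real (Iic a) ≤ ∫ s, f s ∂ρ ∧ ∫ s, f s ∂ρ ≤ ρ.real (Iic b) := by
    intro ρ _
    have hi := hf.integrable_of_hasCompactSupport hf' (μ := ρ)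
    rw [← integral_indicator_one (μ := ρ) (measurableSet_Iic (a := a)),
      ← integral_indicator_one (μ := ρ) (measurableSet_Iic (a := b))]
    exact ⟨integral_mono (integrable_indicator_Iic_one a) hi hfa,
      integral_mono hi (integrable_indicator_Iic_one b) hfb⟩
  filter_upwards [(h f hf hf').eventually (Ioo_mem_nhds (sub_lt_self _ hε)
    (lt_add_of_pos_right _ hε))] with n hn
  have h1 := bounds (ν n)
  have h2 := bounds μ
  constructor <;> linarith [hn.1, hn.2]

/-- A monotone function has countably many discontinuities, and the complement of a countable subset
of `ℝ` is dense. -/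
lemma exists_continuousAt_real_Iic {a b : ℝ≥0} (hab : a < b) :
    ∃ t ∈ Ioo a b, ContinuousAt (fun s => μ.real (Iic s)) t := by
  have hmono : Monotone fun s : ℝ => μ.real (Iic s.toNNReal) := fun s t hst =>
    monotone_real_Iic μ (Real.toNNReal_mono hst)
  obtain ⟨t, ht, hat, htb⟩ := (hmono.countable_not_continuousAt.dense_compl ℝ).exists_between
    (NNReal.coe_lt_coe.2 hab)
  lift t to ℝ≥0 using a.2.trans hat.le
  refine ⟨t, ⟨NNReal.coe_lt_coe.1 hat, NNReal.coe_lt_coe.1 htb⟩, ?_⟩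
  have hc : ContinuousAt (fun s : ℝ => μ.real (Iic s.toNNReal)) (t : ℝ) := by
    simpa using ht
  have := hc.comp (f := fun s : ℝ≥0 => (s : ℝ)) NNReal.continuous_coe.continuousAt
  simpa [Function.comp_def] using this

/-- The Riemann–Stieltjes sum of `f` along the points `d 0 ≤ ⋯ ≤ d M`. -/
noncomputable def stieltjesSum (f : ℝ≥0 → ℝ) (d : ℕ → ℝ≥0) (ρ : Measure ℝ≥0) (M : ℕ) : ℝ :=
  f (d 0) * ρ.real (Iic (d 0)) +
    ∑ k ∈ Finset.range M, f (d (k + 1)) * (ρ.real (Iic (d (k + 1))) - ρ.real (Iic (d k)))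

lemma abs_setIntegral_sub_stieltjesSum_le {f : ℝ≥0 → ℝ} (hf : Integrable f μ) {d : ℕ → ℝ≥0}
    (hd : Monotone d) {ε : ℝ} (h0 : ∀ s ≤ d 0, |f s - f (d 0)| ≤ ε)
    (hk : ∀ k, ∀ s ∈ Ioc (d k) (d (k + 1)), |f s - f (d (k + 1))| ≤ ε) (M : ℕ) :
    |∫ s in Iic (d M), f s ∂μ - stieltjesSum f d μ M| ≤ ε * μ.real (Iic (d M)) := by
  have cell : ∀ (A : Set ℝ≥0) (t : ℝ≥0), MeasurableSet A → μ A ≠ ⊤ →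
      (∀ s ∈ A, |f s - f t| ≤ ε) →
      |∫ s in A, f s ∂μ - f t * μ.real A| ≤ ε * μ.real A := by
    intro A t hA hfin h
    have h1 : ∫ s in A, f s ∂μ - f t * μ.real A = ∫ s in A, (f s - f t) ∂μ := by
      rw [integral_sub hf.integrableOn (integrableOn_const hfin), setIntegral_const, smul_eq_mul,
        mul_comm]
    rw [h1]
    exact norm_setIntegral_le_of_norm_le_const (f := fun s => f s - f t) hfin.lt_top h
  induction M with
  | zero =>
    simpa [stieltjesSum] using cell (Iic (d 0)) (d 0) measurableSet_Iic (measure_Iic_ne_top μ _) h0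
  | succ M ih =>
    have hle : d M ≤ d (M + 1) := hd M.le_succ
    have hfin : μ (Ioc (d M) (d (M + 1))) ≠ ⊤ :=
      measure_ne_top_of_subset_Iic μ (t := d (M + 1)) fun x hx => hx.2
    have h1 := cell _ (d (M + 1)) measurableSet_Ioc hfin (hk M)
    have h2 : μ.real (Iic (d (M + 1))) = μ.real (Iic (d M)) + μ.real (Ioc (d M) (d (M + 1))) := by
      rw [← measureReal_union (Iic_disjoint_Ioc le_rfl) measurableSet_Ioc
        (measure_Iic_ne_top μ _) hfin, Iic_union_Ioc_eq_Iic hle]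
    have h3 : ∫ s in Iic (d (M + 1)), f s ∂μ =
        ∫ s in Iic (d M), f s ∂μ + ∫ s in Ioc (d M) (d (M + 1)), f s ∂μ := by
      rw [← setIntegral_union (Iic_disjoint_Ioc le_rfl) measurableSet_Ioc hf.integrableOn
        hf.integrableOn, Iic_union_Ioc_eq_Iic hle]
    have h4 : stieltjesSum f d μ (M + 1) =
        stieltjesSum f d μ M + f (d (M + 1)) * μ.real (Ioc (d M) (d (M + 1))) := by
      rw [stieltjesSum, Finset.sum_range_succ, ← add_assoc, ← stieltjesSum, h2,
        add_sub_cancel_left]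
    rw [h3, h4, h2, mul_add]
    calc _ = |(∫ s in Iic (d M), f s ∂μ - stieltjesSum f d μ M) +
          (∫ s in Ioc (d M) (d (M + 1)), f s ∂μ -
            f (d (M + 1)) * μ.real (Ioc (d M) (d (M + 1))))| := by
          congr 1
          ring
      _ ≤ _ := (abs_add_le _ _).trans (add_le_add ih h1)

/-- The integral is approximated by a Riemann–Stieltjes sum over continuity points of the limit,
with an error controlled by the mass times the oscillation of `f`; such a sum involves finitely many
convergent distribution values. -/
lemma CdfTendsto.vagueTendsto (h : CdfTendsto ν μ) : VagueTendsto ν μ := by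
  intro f hf hf'
  obtain ⟨K, hK⟩ := hf'.isCompact.bddAbove
  have hfK : ∀ s, K < s → f s = 0 := fun s hs => by
    by_contra h0
    exact absurd (hK (subset_tsupport f h0)) (not_le.2 hs)
  rw [Metric.tendsto_nhds]
  intro ε hε
  set C : ℝ := μ.real (Iic (K + 2)) with hC
  have hC0 : 0 ≤ C := measureReal_nonneg
  -- The approximation error is paid once for `ν n` and once for `μ`, so `2 * ε' * C` must stay
  -- below `ε`; the `+ 1` covers `C = 0`.
  set ε' : ℝ := ε / (2 * C + 1) with hε'
  have hε'0 : 0 < ε' := by positivity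
  have hlt : 2 * (ε' * C) < ε := by
    rw [hε', div_mul_eq_mul_div, mul_div_assoc', div_lt_iff₀ (by positivity)]
    nlinarith
  obtain ⟨δ, hδ, hfδ⟩ := Metric.uniformContinuous_iff.1
    (hf'.uniformContinuous_of_continuous hf) ε' hε'0
  -- Consecutive points `d k`, chosen in adjacent windows of length `η`, are less than `2 * η`
  -- apart; the bound `2` also keeps `d M` below `K + 2`.
  obtain ⟨η, hη, hηδ⟩ : ∃ η : ℝ≥0, 0 < η ∧ 2 * (η : ℝ) ≤ min δ 2 :=
    ⟨Real.toNNReal (min δ 2 / 2), Real.toNNReal_pos.2 (by positivity), by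
      rw [Real.coe_toNNReal _ (by positivity)]; linarith⟩
  have hex : ∀ k : ℕ, ∃ t ∈ Ioo ((k : ℝ≥0) * η) (((k : ℝ≥0) + 1) * η),
      ContinuousAt (fun s => μ.real (Iic s)) t := fun k =>
    exists_continuousAt_real_Iic (by gcongr; exact lt_add_one _)
  choose d hd hdc using hex
  have hd0 : ∀ k, 0 < d k := fun k => bot_lt_of_lt (hd k).1
  have hdlt : ∀ k, d k < d (k + 1) := fun k =>
    (hd k).2.trans (by simpa using (hd (k + 1)).1)
  have hdm : Monotone d := monotone_nat_of_le_succ fun k => (hdlt k).le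
  have hclose : ∀ (k : ℕ) (s : ℝ≥0), (k : ℝ) * η ≤ s → s ≤ d (k + 1) → |f s - f (d (k + 1))| ≤ ε' := by
    intro k s hs hs'
    refine (hfδ ?_).le
    have h1 : (d (k + 1) : ℝ) < (k + 1 + 1) * η := by
      have := NNReal.coe_lt_coe.2 (hd (k + 1)).2
      push_cast at this
      exact this
    rw [NNReal.dist_eq, abs_sub_comm, abs_of_nonneg (sub_nonneg.2 (NNReal.coe_le_coe.2 hs'))]
    nlinarith [min_le_left δ 2]
  have h0 : ∀ s ≤ d 0, |f s - f (d 0)| ≤ ε' := by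
    intro s hs
    refine (hfδ ?_).le
    have h1 : (d 0 : ℝ) < η := by simpa using NNReal.coe_lt_coe.2 (hd 0).2
    rw [NNReal.dist_eq, abs_sub_comm, abs_of_nonneg (sub_nonneg.2 (NNReal.coe_le_coe.2 hs))]
    nlinarith [min_le_left δ 2, s.2]
  have hk : ∀ k, ∀ s ∈ Ioc (d k) (d (k + 1)), |f s - f (d (k + 1))| ≤ ε' := fun k s hs =>
    hclose k s (by exact_mod_cast ((hd k).1.trans hs.1).le) hs.2
  set M := ⌊K / η⌋₊ + 1 with hM
  have hKM : K < d M := by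
    have h1 : K / η < (M : ℕ) := by
      rw [hM]; push_cast; exact Nat.lt_floor_add_one _
    exact ((div_lt_iff₀ hη).1 h1).trans (hd M).1
  have hMK : d M ≤ K + 2 := by
    refine (hd M).2.le.trans ?_
    have h1 : (⌊K / η⌋₊ : ℝ≥0) * η ≤ K :=
      (le_div_iff₀ hη).1 (Nat.floor_le zero_le)
    have h2 : 2 * η ≤ 2 := by
      rw [← NNReal.coe_le_coe]; push_cast; exact hηδ.trans (min_le_right _ _)
    calc ((M : ℕ) + 1 : ℝ≥0) * η = (⌊K / η⌋₊ : ℝ≥0) * η + 2 * η := by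
          rw [hM]; push_cast; ring
      _ ≤ K + 2 := add_le_add h1 h2
  have approx : ∀ (ρ : Measure ℝ≥0) [IsFiniteMeasureOnCompacts ρ],
      |∫ s, f s ∂ρ - stieltjesSum f d ρ M| ≤ ε' * ρ.real (Iic (d M)) := by
    intro ρ _
    have hi := hf.integrable_of_hasCompactSupport hf' (μ := ρ)
    rw [← setIntegral_eq_integral_of_forall_compl_eq_zero (s := Iic (d M))
      fun s hs => hfK s (hKM.trans (not_le.1 hs))]
    exact abs_setIntegral_sub_stieltjesSum_le hi hdm h0 hk M
  have hF : ∀ k, Tendsto (fun n => (ν n).real (Iic (d k))) atTop (𝓝 (μ.real (Iic (d k)))) :=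
    fun k => h.tendsto_real_Iic (hd0 k) (hdc k)
  have hS : Tendsto (fun n => stieltjesSum f d (ν n) M) atTop (𝓝 (stieltjesSum f d μ M)) :=
    ((hF 0).const_mul _).add
      (tendsto_finsetSum _ fun k _ => ((hF (k + 1)).sub (hF k)).const_mul _)
  have hbound : Tendsto (fun n => ε' * (ν n).real (Iic (d M)) +
      |stieltjesSum f d (ν n) M - stieltjesSum f d μ M| + ε' * μ.real (Iic (d M))) atTop
      (𝓝 (ε' * μ.real (Iic (d M)) + |stieltjesSum f d μ M - stieltjesSum f d μ M| +
        ε' * μ.real (Iic (d M)))) :=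
    (((hF M).const_mul _).add (hS.sub_const _).abs).add_const _
  have hlim : ε' * μ.real (Iic (d M)) + |stieltjesSum f d μ M - stieltjesSum f d μ M| +
      ε' * μ.real (Iic (d M)) < ε := by
    have := mul_le_mul_of_nonneg_left (monotone_real_Iic μ hMK) hε'0.le
    simp only [sub_self, abs_zero]
    linarith
  filter_upwards [hbound.eventually (gt_mem_nhds hlim)] with n hn
  refine lt_of_le_of_lt ?_ hn
  have h1 := abs_le.1 (approx (ν n))
  have h2 := abs_le.1 (approx μ)
  rw [Real.dist_eq, abs_le]
  constructor <;> linarith [h1.1, h1.2, h2.1, h2.2,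
    neg_abs_le (stieltjesSum f d (ν n) M - stieltjesSum f d μ M),
    le_abs_self (stieltjesSum f d (ν n) M - stieltjesSum f d μ M)]

end Vague

/-! ### Construction of time changes and diagonal selection. -/

section TimeChange

/-- A bounded perturbation of the identity with Lipschitz constant below `1` which fixes `0` is an
increasing bijection of `[0, ∞)`. -/
lemma exists_orderIso_of_lipschitz {h : ℝ → ℝ} {K C : ℝ} (hK : K < 1)
    (hlip : ∀ a b, |h a - h b| ≤ K * |a - b|) (h0 : h 0 = 0) (hC : ∀ s, |h s| ≤ C) :
    ∃ l : ℝ≥0 ≃o ℝ≥0, ∀ s : ℝ≥0, (l s : ℝ) = s + h s := by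
  have hK0 : 0 ≤ K := by simpa using (abs_nonneg _).trans (hlip 1 0)
  have hcont : Continuous h :=
    (LipschitzWith.of_dist_le_mul (K := ⟨K, hK0⟩) fun a b => hlip a b).continuous
  have hmono : StrictMono fun s => s + h s := fun a b hab => by
    have h1 := (abs_le.1 (hlip b a)).1
    rw [abs_of_pos (sub_pos.2 hab)] at h1
    simp only
    nlinarith
  have hsurj : Function.Surjective fun s => s + h s := by
    refine (continuous_id.add hcont).surjective ?_ ?_
    · exact tendsto_atTop_add_right_of_le _ (-C) tendsto_id fun s => (abs_le.1 (hC s)).1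
    · exact tendsto_atBot_add_right_of_ge _ C tendsto_id fun s => (abs_le.1 (hC s)).2
  have hpos : ∀ s : ℝ≥0, 0 ≤ (s : ℝ) + h s := fun s => by
    simpa [h0] using hmono.monotone s.2
  have hcoe : ∀ s : ℝ≥0, (((s : ℝ) + h s).toNNReal : ℝ) = s + h s := fun s =>
    Real.coe_toNNReal _ (hpos s)
  refine ⟨StrictMono.orderIsoOfSurjective (fun s : ℝ≥0 => ((s : ℝ) + h s).toNNReal) ?_ ?_, hcoe⟩
  · intro a b hab
    rw [← NNReal.coe_lt_coe, hcoe, hcoe]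
    exact hmono hab
  · intro t
    obtain ⟨s, hs⟩ := hsurj t
    have hs0 : 0 ≤ s := by
      by_contra hneg
      have := hmono (not_le.1 hneg)
      simp only [h0, add_zero] at this hs
      exact absurd t.2 (not_le.2 (hs.symm.trans_lt this))
    lift s to ℝ≥0 using hs0
    exact ⟨s, NNReal.coe_injective ((hcoe s).trans hs)⟩

lemma exists_pos_le_of_forall_pos {α : Type*} (S : Finset α) (f : α → ℝ) (h : ∀ x ∈ S, 0 < f x) :
    ∃ g : ℝ, 0 < g ∧ ∀ x ∈ S, g ≤ f x := by
  classical
  induction S using Finset.induction_on with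
  | empty => exact ⟨1, one_pos, by simp⟩
  | insert a S _ ih =>
    obtain ⟨g, hg, hg'⟩ := ih fun x hx => h x (Finset.mem_insert_of_mem hx)
    refine ⟨min g (f a), lt_min hg (h a (Finset.mem_insert_self a S)), fun x hx => ?_⟩
    rcases Finset.mem_insert.1 hx with rfl | hx
    · exact min_le_right _ _
    · exact (min_le_left _ _).trans (hg' x hx)

lemma abs_max_zero_sub_le (a b : ℝ) : |max 0 a - max 0 b| ≤ |a - b| := by
  simpa using abs_max_sub_max_le_max 0 a 0 b

/-- Small displacements of finitely many positive times extend to a time change close to the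
identity. -/
lemma exists_timeChange (G : Finset ℝ≥0) (hG : ∀ u ∈ G, 0 < u) {ε : ℝ} (hε : 0 < ε) :
    ∃ δ : ℝ, 0 < δ ∧ ∀ v : ℝ≥0 → ℝ≥0, (∀ u ∈ G, dist (v u) u < δ) →
      ∃ l : ℝ≥0 ≃o ℝ≥0, (∀ u ∈ G, l u = v u) ∧ ∀ s, dist (l s) s < ε := by
  obtain ⟨g₁, hg₁, hg₁'⟩ := exists_pos_le_of_forall_pos G (fun u => (u : ℝ)) hG
  obtain ⟨g₂, hg₂, hg₂'⟩ := exists_pos_le_of_forall_pos G.offDiag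
    (fun u => |(u.1 : ℝ) - u.2|) fun u hu => abs_pos.2 (sub_ne_zero.2 fun h =>
      (Finset.mem_offDiag.1 hu).2.2 (NNReal.coe_injective h))
  set g := min g₁ g₂ with hg
  have hg0 : 0 < g := lt_min hg₁ hg₂
  -- The displacements then sum to at most `min ε g / 2`: below `ε` for closeness to the identity,
  -- and at most `g / 2` so that tents of slope `1 / g` give Lipschitz constant `1 / 2`.
  set δ : ℝ := min ε g / (2 * (G.card + 1)) with hδ
  have hδ0 : 0 < δ := by have := lt_min hε hg0; positivity
  have hcard : G.card * δ ≤ min ε g / 2 := by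
    have : min ε g / 2 = (G.card + 1) * δ := by rw [hδ]; field_simp
    rw [this]
    nlinarith
  refine ⟨δ, hδ0, fun v hv => ?_⟩
  -- Each tent has half-width `g`, so it vanishes at `0` and at every other point of `G`; the
  -- displacement at `u` is exactly `v u - u`.
  set tent : ℝ → ℝ → ℝ := fun u s => max 0 (1 - |s - u| / g) with htent
  have htent_le : ∀ u s, |tent u s| ≤ 1 := fun u s => by
    have h1 : 0 ≤ |s - u| / g := div_nonneg (abs_nonneg _) hg0.le
    have h2 : 0 ≤ tent u s := le_max_left _ _
    rw [abs_of_nonneg h2]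
    exact max_le zero_le_one (sub_le_self 1 h1)
  have htent_lip : ∀ u a b, |tent u a - tent u b| ≤ |a - b| / g := fun u a b => by
    refine (abs_max_zero_sub_le _ _).trans ?_
    rw [sub_sub_sub_cancel_left, ← sub_div, abs_div, abs_of_pos hg0]
    refine div_le_div_of_nonneg_right ?_ hg0.le
    have h := abs_abs_sub_abs_le (b - u) (a - u)
    rwa [sub_sub_sub_cancel_right, abs_sub_comm b a] at h
  have htent_self : ∀ u, tent u u = 1 := fun u => by simp [htent]
  have htent_zero : ∀ u s, g ≤ |s - u| → tent u s = 0 := fun u s h =>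
    max_eq_left (sub_nonpos.2 ((one_le_div hg0).2 h))
  set h : ℝ → ℝ := fun s => ∑ u ∈ G, ((v u : ℝ) - u) * tent u s with hh
  have hsum : ∑ u ∈ G, |(v u : ℝ) - u| ≤ min ε g / 2 := by
    refine le_trans ?_ hcard
    rw [← nsmul_eq_mul]
    exact Finset.sum_le_card_nsmul _ _ _ fun u hu => (hv u hu).le
  have hbound : ∀ s, |h s| ≤ min ε g / 2 := fun s => by
    refine (Finset.abs_sum_le_sum_abs _ _).trans ((Finset.sum_le_sum fun u _ => ?_).trans hsum)
    rw [abs_mul]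
    exact mul_le_of_le_one_right (abs_nonneg _) (htent_le _ _)
  have hlip : ∀ a b, |h a - h b| ≤ 1 / 2 * |a - b| := fun a b => by
    calc |h a - h b| = |∑ u ∈ G, ((v u : ℝ) - u) * (tent u a - tent u b)| := by
          simp only [hh, ← Finset.sum_sub_distrib, mul_sub]
      _ ≤ ∑ u ∈ G, |(v u : ℝ) - u| * (|a - b| / g) := by
          refine (Finset.abs_sum_le_sum_abs _ _).trans (Finset.sum_le_sum fun u _ => ?_)
          rw [abs_mul]
          gcongr
          exact htent_lip _ _ _
      _ = (∑ u ∈ G, |(v u : ℝ) - u|) * (|a - b| / g) := by rw [Finset.sum_mul]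
      _ ≤ g / 2 * (|a - b| / g) := by
          gcongr
          exact hsum.trans (by gcongr; exact min_le_right _ _)
      _ = 1 / 2 * |a - b| := by field_simp
  have h0 : h 0 = 0 := Finset.sum_eq_zero fun u hu => by
    rw [htent_zero u 0, mul_zero]
    rw [zero_sub, abs_neg, NNReal.abs_eq]
    exact (min_le_left _ _).trans (hg₁' u hu)
  obtain ⟨l, hl⟩ := exists_orderIso_of_lipschitz (by norm_num) hlip h0 hbound
  refine ⟨l, fun u hu => ?_, fun s => ?_⟩
  · apply NNReal.coe_injective
    rw [hl, hh]
    simp only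
    rw [Finset.sum_eq_single_of_mem u hu, htent_self, mul_one, add_sub_cancel]
    intro w hw hwu
    rw [htent_zero, mul_zero]
    exact (min_le_right _ _).trans (hg₂' (u, w) (Finset.mem_offDiag.2 ⟨hu, hw, hwu.symm⟩))
  · rw [NNReal.dist_eq, hl, add_sub_cancel_left]
    exact (hbound s).trans_lt (by linarith [min_le_left ε g])

/-- Diagonal selection. -/
lemma exists_seq_of_forall_eventually_exists {α : Type*} {P : ℕ → ℕ → α → Prop}
    (hP : ∀ n a, Antitone fun k => P k n a) (h : ∀ k, ∀ᶠ n in atTop, ∃ a, P k n a) :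
    ∃ a : ℕ → α, ∀ k, ∀ᶠ n in atTop, P k n (a n) := by
  classical
  obtain ⟨n₀, a₀, -⟩ := (h 0).exists
  -- At stage `n`, take a witness for the largest achievable level `k ≤ n`; `a₀` is a default for
  -- when no level is achievable.
  have hex : ∀ n, ∃ a, (∃ k ≤ n, ∃ a, P k n a) →
      P (Nat.findGreatest (fun k => ∃ a, P k n a) n) n a := fun n => by
    by_cases hn : ∃ k ≤ n, ∃ a, P k n a
    · obtain ⟨k, hk, hk'⟩ := hn
      obtain ⟨a, ha⟩ := Nat.findGreatest_spec (P := fun k => ∃ a, P k n a) hk hk'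
      exact ⟨a, fun _ => ha⟩
    · exact ⟨a₀, fun h => absurd h hn⟩
  choose a ha using hex
  refine ⟨a, fun k => ?_⟩
  filter_upwards [h k, eventually_ge_atTop k] with n hn hkn
  exact hP n (a n) (Nat.le_findGreatest hkn hn) (ha n ⟨k, hkn, hn⟩)

end TimeChange

/-! ### Finite grids whose open cells have small mass. -/

section Grid

variable {ι : Type*} [Finite ι] (μ : ι → Measure ℝ≥0) [∀ i, IsFiniteMeasureOnCompacts (μ i)]

lemma exists_right_nhds_small (s : ℝ≥0) {ε : ℝ} (hε : 0 < ε) :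
    ∃ b, s < b ∧ ∀ i, (μ i).real (Ioo s b) < ε := by
  have h : ∀ᶠ b in 𝓝[>] s, ∀ i, (μ i).real (Ioo s b) < ε := by
    refine eventually_all.2 fun i => ?_
    have h1 := ((continuousWithinAt_real_Iic (μ i) s).mono Ioi_subset_Ici_self).eventually
      (gt_mem_nhds (lt_add_of_pos_right _ hε))
    filter_upwards [h1, self_mem_nhdsWithin] with b hb hsb
    have h2 := real_Iio_eq_real_Iic_add (μ i) hsb
    have h3 := real_Iic_eq_real_Iio_add (μ i) b
    have h4 : 0 ≤ (μ i).real {b} := measureReal_nonneg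
    linarith
  obtain ⟨b, hb, hsb⟩ := (h.and self_mem_nhdsWithin).exists
  exact ⟨b, hsb, hb⟩

lemma exists_left_nhds_small {s : ℝ≥0} (hs : 0 < s) {ε : ℝ} (hε : 0 < ε) :
    ∃ a, a < s ∧ ∀ i, (μ i).real (Ioo a s) < ε := by
  have : (𝓝[<] s).NeBot := nhdsLT_neBot_of_exists_lt ⟨0, hs⟩
  have h : ∀ᶠ a in 𝓝[<] s, ∀ i, (μ i).real (Ioo a s) < ε := by
    refine eventually_all.2 fun i => ?_
    filter_upwards [(tendsto_real_Iic_left (μ i) s).eventually (lt_mem_nhds (sub_lt_self _ hε)),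
      self_mem_nhdsWithin] with a ha has
    have h2 := real_Iio_eq_real_Iic_add (μ i) has
    linarith
  obtain ⟨a, ha, has⟩ := (h.and self_mem_nhdsWithin).exists
  exact ⟨a, has, ha⟩

/-- Every time in `[0, N]` lies in a cell `[u, u')` with endpoints in a finite set whose interior
has small mass. -/
lemma exists_grid (N : ℝ≥0) {ε : ℝ} (hε : 0 < ε) :
    ∃ G : Finset ℝ≥0, ∀ s ≤ N, ∃ u ∈ G, ∃ u' ∈ G, u ≤ s ∧ s < u' ∧
      ∀ i, (μ i).real (Ioo u u') < ε := by
  classical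
  let P : Set ℝ≥0 → Prop := fun S => ∃ G : Finset ℝ≥0, ∀ s ∈ S, ∃ u ∈ G, ∃ u' ∈ G, u ≤ s ∧ s < u' ∧
      ∀ i, (μ i).real (Ioo u u') < ε
  have hc : IsCompact (Iic N) := by
    have h : Iic N = Icc 0 N := by ext; simp
    exact h ▸ isCompact_Icc
  -- Compactness of `[0, N]`: locally around `s`, cutting at `s` itself puts a possible atom there
  -- at an endpoint, outside the open cells.
  refine hc.induction_on (p := P) ⟨∅, by simp⟩ (fun S T hST ⟨G, hG⟩ => ⟨G, fun s hs =>
    hG s (hST hs)⟩) ?_ fun s _ => ?_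
  · rintro S T ⟨G, hG⟩ ⟨H, hH⟩
    refine ⟨G ∪ H, fun s hs => ?_⟩
    rcases hs with hs | hs
    · obtain ⟨u, hu, u', hu', h⟩ := hG s hs
      exact ⟨u, Finset.mem_union_left _ hu, u', Finset.mem_union_left _ hu', h⟩
    · obtain ⟨u, hu, u', hu', h⟩ := hH s hs
      exact ⟨u, Finset.mem_union_right _ hu, u', Finset.mem_union_right _ hu', h⟩
  · obtain ⟨b, hsb, hb⟩ := exists_right_nhds_small μ s hε
    rcases eq_zero_or_pos s with rfl | hs
    · refine ⟨Iio b, mem_nhdsWithin_of_mem_nhds (Iio_mem_nhds hsb), {0, b}, fun r hr => ?_⟩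
      exact ⟨0, by simp, b, by simp, zero_le, hr, hb⟩
    · obtain ⟨a, has, ha⟩ := exists_left_nhds_small μ hs hε
      refine ⟨Ioo a b, mem_nhdsWithin_of_mem_nhds (Ioo_mem_nhds has hsb), {a, s, b},
        fun r hr => ?_⟩
      rcases lt_or_ge r s with h | h
      · exact ⟨a, by simp, s, by simp, hr.1.le, h, ha⟩
      · exact ⟨s, by simp, b, by simp, h, hr.2, hb⟩

end Grid

/-! ### Common time changes from convergence of distribution functions. -/

section Convergence

variable {π : ℕ → TimePartition}

/-- The endpoints depend on the partitions alone, not on any path; this is what makes a common time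
change possible. -/
lemma IsVanishing.exists_seq_mem_Ioc (hπ : IsVanishing π) {u : ℝ≥0} (hu : 0 < u) :
    ∃ v w : ℕ → ℝ≥0, Tendsto v atTop (𝓝 u) ∧ Tendsto w atTop (𝓝 u) ∧ ∀ᶠ n in atTop,
      v n < u ∧ u ≤ w n ∧ ∃ i : Fin (π n).k, (π n).t i.castSucc = v n ∧ (π n).t i.succ = w n := by
  have hex : ∀ n, ∃ v w : ℝ≥0, u ≤ (π n).t (Fin.last (π n).k) → v < u ∧ u ≤ w ∧
      ∃ i : Fin (π n).k, (π n).t i.castSucc = v ∧ (π n).t i.succ = w := fun n => by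
    by_cases h : u ≤ (π n).t (Fin.last (π n).k)
    · obtain ⟨i, hi, hi'⟩ := (π n).exists_mem_Ioc hu h
      exact ⟨_, _, fun _ => ⟨hi, hi', i, rfl, rfl⟩⟩
    · exact ⟨0, 0, fun h' => absurd h' h⟩
  choose v w hvw using hex
  have hev : ∀ᶠ n in atTop, v n < u ∧ u ≤ w n ∧
      ∃ i : Fin (π n).k, (π n).t i.castSucc = v n ∧ (π n).t i.succ = w n :=
    (hπ.1.eventually (eventually_ge_atTop u)).mono fun n hn => hvw n hn
  refine ⟨v, w, tendsto_order.2 ⟨fun a ha => ?_, fun b hb => ?_⟩,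
    tendsto_order.2 ⟨fun a ha => ?_, fun b hb => ?_⟩, hev⟩
  · filter_upwards [hev, hπ.eventually_succ_lt ha] with n ⟨_, h2, i, hi, hi'⟩ h
    by_contra hle
    exact absurd (h i (hi ▸ not_lt.1 hle)) (not_lt.2 (hi' ▸ h2))
  · filter_upwards [hev] with n hn using hn.1.trans hb
  · filter_upwards [hev] with n hn using ha.trans_le hn.2.1
  · filter_upwards [hev, hπ.eventually_succ_lt hb] with n ⟨h1, _, i, hi, hi'⟩ h
    exact hi' ▸ h i (hi ▸ h1.le)

lemma IsCadlag.eventually_lt_sqMeasure_singleton {y : ℝ≥0 → ℝ} (hy : IsCadlag y) {u : ℝ≥0}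
    {v w : ℕ → ℝ≥0} (hv : Tendsto v atTop (𝓝 u)) (hw : Tendsto w atTop (𝓝 u))
    (hvw : ∀ᶠ n in atTop, v n < u ∧ u ≤ w n ∧
      ∃ i : Fin (π n).k, (π n).t i.castSucc = v n ∧ (π n).t i.succ = w n) {ε : ℝ} (hε : 0 < ε) :
    ∀ᶠ n in atTop, jump y u ^ 2 - ε < (sqMeasure (π n) y).real {v n} := by
  obtain ⟨W, hW, -, h⟩ := hy.exists_nhds_sq_increment u hε
  filter_upwards [hv.eventually hW, hw.eventually hW, hvw] with n h1 h2 ⟨h3, h4, i, hi, hi'⟩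
  have := h _ h1 _ h2 h3 h4
  rwa [← hi, sqMeasure_real_singleton, hi, hi']

/-- At the last partition point before a positive time `u`, the discrete distribution functions and
their left limits converge to the values at `u`. -/
lemma CdfTendsto.tendsto_real_partition {y : ℝ≥0 → ℝ} (hy : IsCadlag y) {μ : Measure ℝ≥0}
    [IsFiniteMeasureOnCompacts μ] (hμ : CdfTendsto (fun n => sqMeasure (π n) y) μ) {u : ℝ≥0}
    (hu : 0 < u) (hjump : μ.real {u} = jump y u ^ 2)
    {v w : ℕ → ℝ≥0} (hv : Tendsto v atTop (𝓝 u)) (hw : Tendsto w atTop (𝓝 u))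
    (hvw : ∀ᶠ n in atTop, v n < u ∧ u ≤ w n ∧
      ∃ i : Fin (π n).k, (π n).t i.castSucc = v n ∧ (π n).t i.succ = w n) :
    Tendsto (fun n => (sqMeasure (π n) y).real (Iic (v n))) atTop (𝓝 (μ.real (Iic u))) ∧
      Tendsto (fun n => (sqMeasure (π n) y).real (Iio (v n))) atTop (𝓝 (μ.real (Iio u))) := by
  have hne : (𝓝[<] u).NeBot := nhdsLT_neBot_of_exists_lt ⟨0, hu⟩
  have key : ∀ ε : ℝ, 0 < ε → ∀ᶠ n in atTop,
      |(sqMeasure (π n) y).real (Iic (v n)) - μ.real (Iic u)| < 4 * ε ∧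
        |(sqMeasure (π n) y).real (Iio (v n)) - μ.real (Iio u)| < 4 * ε := by
    intro ε hε
    obtain ⟨a, ha, hau⟩ := (((tendsto_real_Iic_left μ u).eventually
      (lt_mem_nhds (sub_lt_self _ hε))).and self_mem_nhdsWithin).exists
    obtain ⟨b, hb, hub⟩ := ((((continuousWithinAt_real_Iic μ u).mono
      Ioi_subset_Ici_self).eventually
      (gt_mem_nhds (lt_add_of_pos_right _ hε))).and self_mem_nhdsWithin).exists
    obtain ⟨a', haa', ha'u⟩ := exists_between (show a < u from hau)
    filter_upwards [hμ a a' haa' ε hε, hμ u b hub ε hε, hv.eventually (lt_mem_nhds ha'u), hvw,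
      hy.eventually_lt_sqMeasure_singleton hv hw hvw hε] with n h1 h2 h3 h4 h5
    have h6 := real_Iic_eq_real_Iio_add μ u
    have h7 := real_Iic_eq_real_Iio_add (sqMeasure (π n) y) (v n)
    have h8 := real_Iic_le_real_Iio (sqMeasure (π n) y) h3
    have h9 := monotone_real_Iic (sqMeasure (π n) y) h4.1.le
    simp only at h9 hb
    -- Interlacing bounds `F_n(v_n)` from above by `F(u)` and `F_n(v_n-)` from below by `F(u-)`, up
    -- to errors; the lower bound on the atom at `v_n`, which links the two, gives the opposite
    -- bounds.
    constructor <;> rw [abs_lt] <;> constructor <;> linarith [h1.2, h2.1]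
  constructor
  · refine Metric.tendsto_nhds.2 fun ε hε => ?_
    filter_upwards [key (ε / 4) (by positivity)] with n hn
    simpa [Real.dist_eq, mul_div_cancel₀] using hn.1
  · refine Metric.tendsto_nhds.2 fun ε hε => ?_
    filter_upwards [key (ε / 4) (by positivity)] with n hn
    simpa [Real.dist_eq, mul_div_cancel₀] using hn.2

lemma CdfTendsto.tendsto_real_Iic_zero {ν : ℕ → Measure ℝ≥0} {μ : Measure ℝ≥0}
    [IsFiniteMeasureOnCompacts μ] (hμ : CdfTendsto ν μ) (h0 : μ.real {0} = 0) :
    μ.real (Iic 0) = 0 ∧ Tendsto (fun n => (ν n).real (Iic 0)) atTop (𝓝 0) := by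
  have h1 : μ.real (Iic 0) = 0 := by
    rw [real_Iic_eq_real_Iio_add, h0]
    simp
  refine ⟨h1, Metric.tendsto_nhds.2 fun ε hε => ?_⟩
  obtain ⟨b, hb, hub⟩ := ((((continuousWithinAt_real_Iic μ 0).mono
    Ioi_subset_Ici_self).eventually
    (gt_mem_nhds (lt_add_of_pos_right _ (half_pos hε)))).and self_mem_nhdsWithin).exists
  filter_upwards [hμ 0 b hub _ (half_pos hε)] with n hn
  simp only [h1] at hb
  rw [Real.dist_eq, sub_zero, abs_of_nonneg measureReal_nonneg]
  linarith [hn.1]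

variable {ι : Type*} [Finite ι] {y : ι → ℝ≥0 → ℝ} {μ : ι → Measure ℝ≥0}
  [∀ i, IsFiniteMeasureOnCompacts (μ i)]

lemma eventually_exists_timeChange (hπ : IsVanishing π) (hy : ∀ i, IsCadlag (y i))
    (hμ : ∀ i, CdfTendsto (fun n => sqMeasure (π n) (y i)) (μ i))
    (hjump : ∀ i u, (μ i).real {u} = jump (y i) u ^ 2) (N : ℝ≥0) {ε : ℝ} (hε : 0 < ε) :
    ∀ᶠ n in atTop, ∃ l : ℝ≥0 ≃o ℝ≥0, (∀ s, dist (l s) s < ε) ∧ ∀ s ≤ N, ∀ i,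
      dist ((sqMeasure (π n) (y i)).real (Iic (l s))) ((μ i).real (Iic s)) < ε := by
  classical
  have hε2 := half_pos hε
  obtain ⟨G, hG⟩ := exists_grid μ N hε2
  -- Time changes fix `0`, so that grid point is left out and matched with `v 0 = 0` instead.
  obtain ⟨δ, hδ, htc⟩ := exists_timeChange (G.erase 0)
    (fun u hu => pos_iff_ne_zero.2 (Finset.ne_of_mem_erase hu)) hε
  have hv : ∀ u : ℝ≥0, ∃ v : ℕ → ℝ≥0, (u = 0 → v = 0) ∧ Tendsto v atTop (𝓝 u) ∧ ∀ i,
      Tendsto (fun n => (sqMeasure (π n) (y i)).real (Iic (v n))) atTop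
        (𝓝 ((μ i).real (Iic u))) ∧
      Tendsto (fun n => (sqMeasure (π n) (y i)).real (Iio (v n))) atTop
        (𝓝 ((μ i).real (Iio u))) := by
    intro u
    rcases eq_zero_or_pos u with rfl | hu
    · refine ⟨0, fun _ => rfl, tendsto_const_nhds, fun i => ⟨?_, by simp⟩⟩
      obtain ⟨h1, h2⟩ := (hμ i).tendsto_real_Iic_zero (by rw [hjump, jump_zero]; simp)
      rw [h1]
      exact h2
    · obtain ⟨v, w, hv, hw, hvw⟩ := hπ.exists_seq_mem_Ioc hu
      exact ⟨v, fun h => absurd h hu.ne', hv, fun i =>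
        (hμ i).tendsto_real_partition (hy i) hu (hjump i u) hv hw hvw⟩
  choose v hv0 hv hvμ using hv
  have hev : ∀ᶠ n in atTop, ∀ u ∈ G, dist (v u n) u < δ ∧ ∀ i,
      (μ i).real (Iic u) - ε / 2 < (sqMeasure (π n) (y i)).real (Iic (v u n)) ∧
      (sqMeasure (π n) (y i)).real (Iio (v u n)) < (μ i).real (Iio u) + ε / 2 := by
    refine (eventually_all_finset G).2 fun u _ => ?_
    refine ((hv u).eventually (Metric.ball_mem_nhds _ hδ)).and (eventually_all.2 fun i => ?_)
    exact ((hvμ u i).1.eventually (lt_mem_nhds (sub_lt_self _ hε2))).and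
      ((hvμ u i).2.eventually (gt_mem_nhds (lt_add_of_pos_right _ hε2)))
  filter_upwards [hev] with n hn
  obtain ⟨l, hl, hl'⟩ := htc (fun u => v u n) fun u hu => (hn u (Finset.mem_of_mem_erase hu)).1
  have hlG : ∀ u ∈ G, l u = v u n := fun u hu => by
    rcases eq_or_ne u 0 with rfl | h
    · rw [hv0 0 rfl]
      exact map_bot l
    · exact hl u (Finset.mem_erase.2 ⟨h, hu⟩)
  refine ⟨l, hl', fun s hs i => ?_⟩
  -- For `s` in `[u, u')`, both `F(s)` and `F_n(l s)` are squeezed between values at `u` and left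
  -- limits at `u'`, and `F` grows by less than `ε / 2` across the open cell.
  obtain ⟨u, hu, u', hu', hus, hsu', hsmall⟩ := hG s hs
  have h1 := ((hn u hu).2 i).1
  have h2 := ((hn u' hu').2 i).2
  rw [← hlG u hu] at h1
  rw [← hlG u' hu'] at h2
  have h3 := monotone_real_Iic (sqMeasure (π n) (y i)) (l.monotone hus)
  have h4 := real_Iic_le_real_Iio (sqMeasure (π n) (y i)) (l.strictMono hsu')
  have h5 := real_Iio_eq_real_Iic_add (μ i) (hus.trans_lt hsu')
  have h6 := monotone_real_Iic (μ i) hus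
  have h7 := real_Iic_le_real_Iio (μ i) hsu'
  have h8 := hsmall i
  simp only at h3 h6
  rw [Real.dist_eq, abs_lt]
  constructor <;> linarith

/-- The discrete quadratic variations of finitely many càdlàg paths converge in the Skorokhod sense,
with a common time change, as soon as their distribution functions converge to that of a measure
whose atoms are the squared jumps. -/
lemma exists_timeChanges (hπ : IsVanishing π) (hy : ∀ i, IsCadlag (y i))
    (hμ : ∀ i, CdfTendsto (fun n => sqMeasure (π n) (y i)) (μ i))
    (hjump : ∀ i u, (μ i).real {u} = jump (y i) u ^ 2) :
    ∃ l : ℕ → (ℝ≥0 ≃o ℝ≥0), TendstoUniformly (fun n s => l n s) (fun s => s) atTop ∧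
      ∀ i N, TendstoUniformlyOn (fun n s => (sqMeasure (π n) (y i)).real (Iic (l n s)))
        (fun s => (μ i).real (Iic s)) atTop (Iic N) := by
  obtain ⟨l, hl⟩ := exists_seq_of_forall_eventually_exists
    (P := fun k n (l : ℝ≥0 ≃o ℝ≥0) => (∀ s, dist (l s) s < 1 / ((k : ℝ) + 1)) ∧
      ∀ s ≤ (k : ℝ≥0), ∀ i, dist ((sqMeasure (π n) (y i)).real (Iic (l s)))
        ((μ i).real (Iic s)) < 1 / ((k : ℝ) + 1))
    (fun n l k k' hkk' h => by
      have h1 : 1 / ((k' : ℝ) + 1) ≤ 1 / ((k : ℝ) + 1) := by gcongr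
      exact ⟨fun s => (h.1 s).trans_le h1, fun s hs i =>
        (h.2 s (hs.trans (by gcongr)) i).trans_le h1⟩)
    fun k => eventually_exists_timeChange hπ hy hμ hjump k (by positivity)
  refine ⟨l, Metric.tendstoUniformly_iff.2 fun ε hε => ?_,
    fun i N => Metric.tendstoUniformlyOn_iff.2 fun ε hε => ?_⟩
  · obtain ⟨k, hk⟩ := exists_nat_one_div_lt hε
    filter_upwards [hl k] with n hn s
    rw [dist_comm]
    exact (hn.1 s).trans hk
  · obtain ⟨k₁, hk₁⟩ := exists_nat_one_div_lt hε
    obtain ⟨k₂, hk₂⟩ := exists_nat_ge N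
    filter_upwards [hl (max k₁ k₂)] with n hn s hs
    rw [dist_comm]
    refine (hn.2 s ((mem_Iic.1 hs).trans (hk₂.trans (by gcongr; exact le_max_right _ _))) i).trans
      (lt_of_le_of_lt ?_ hk₁)
    gcongr
    exact le_max_left _ _

end Convergence

/-! ### Föllmer's condition for a scalar path. -/

section Scalar

variable {π : ℕ → TimePartition} {y : ℝ≥0 → ℝ}

lemma IsFollmerQV.exists_measure {q : ℝ≥0 → ℝ} (h : IsFollmerQV π y q) :
    ∃ μ : Measure ℝ≥0, IsFiniteMeasureOnCompacts μ ∧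
      CdfTendsto (fun n => sqMeasure (π n) y) μ ∧ (∀ u, μ.real {u} = jump y u ^ 2) ∧
      q = fun t => μ.real (Iic t) := by
  obtain ⟨μ, hreg, hvague, hq, hsum, hcont, -, h0⟩ := h
  obtain rfl : q = fun t => μ.real (Iic t) := funext hq
  refine ⟨μ, inferInstance, hvague.cdfTendsto, fun u => ?_, rfl⟩
  rcases eq_zero_or_pos u with rfl | hu
  · rw [tsum_Iic_zero (g := fun s => jump y s ^ 2), jump_zero] at h0
    simp only [real_Iic_eq_real_Iio_add] at h0
    rw [jump_zero]
    simpa using h0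
  · exact real_singleton_eq_of_continuous μ (g := fun s => jump y s ^ 2)
      (fun _ => sq_nonneg _) hsum hcont hu

lemma isFollmerQV_of_cdfTendsto {μ : Measure ℝ≥0} [IsFiniteMeasureOnCompacts μ]
    (h : CdfTendsto (fun n => sqMeasure (π n) y) μ) (hjump : ∀ u, μ.real {u} = jump y u ^ 2) :
    IsFollmerQV π y fun t => μ.real (Iic t) := by
  simp only [IsFollmerQV, ← hjump]
  refine ⟨μ, inferInstance, h.vagueTendsto, fun _ => rfl, summable_real_singleton μ,
    continuous_real_Iic_sub_tsum μ, monotone_real_Iic_sub_tsum μ, ?_⟩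
  rw [tsum_Iic_zero (g := fun s => μ.real {s}), real_Iic_eq_real_Iio_add]
  simp

/-- An atom of the limit is at most the discrete atom at `l n u`, up to errors, by uniform
convergence; that atom is bounded by the squared jump. The reverse inequality needs only `hcdf`: the
atom of the interval straddling `u` persists in the limit. -/
lemma real_singleton_eq_sq_jump (hπ : IsVanishing π) (hy : IsCadlag y) {μ : Measure ℝ≥0}
    [IsFiniteMeasureOnCompacts μ] {l : ℕ → (ℝ≥0 ≃o ℝ≥0)}
    (hl : ∀ s, Tendsto (fun n => l n s) atTop (𝓝 s)) {u : ℝ≥0} (hu : 0 < u)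
    (hcdf : CdfTendsto (fun n => sqMeasure (π n) y) μ)
    (hunif : TendstoUniformlyOn (fun n s => (sqMeasure (π n) y).real (Iic (l n s)))
      (fun s => μ.real (Iic s)) atTop (Iic u)) :
    μ.real {u} = jump y u ^ 2 := by
  have hne : (𝓝[<] u).NeBot := nhdsLT_neBot_of_exists_lt ⟨0, hu⟩
  have hatom := real_Iic_eq_real_Iio_add μ u
  refine le_antisymm (le_of_forall_pos_le_add fun ε hε => ?_)
    (le_of_forall_pos_le_add fun ε hε => ?_)
  · have hε' : 0 < ε / 4 := by positivity
    obtain ⟨n, hn, hn'⟩ := ((Metric.tendstoUniformlyOn_iff.1 hunif _ hε').and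
      (hy.eventually_sqMeasure_singleton_lt hπ (hl u) hε')).exists
    have : (𝓝[<] (l n u)).NeBot := nhdsLT_neBot_of_exists_lt
      ⟨l n 0, (l n).strictMono hu⟩
    -- The point `c` realises the left limit of the discrete function at `l n u`; pulled back by the
    -- time change it lies before `u`, where uniform convergence applies with the same `n`.
    obtain ⟨c, hc, hcu⟩ := (((tendsto_real_Iic_left (sqMeasure (π n) y) (l n u)).eventually
      (lt_mem_nhds (sub_lt_self _ hε'))).and self_mem_nhdsWithin).exists
    have hs : (l n).symm c < u := (l n).symm_apply_lt.2 hcu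
    have h1 := abs_lt.1 (Real.dist_eq _ _ ▸ hn u (mem_Iic.2 le_rfl))
    have h2 := abs_lt.1 (Real.dist_eq _ _ ▸ hn _ (mem_Iic.2 hs.le))
    rw [OrderIso.apply_symm_apply] at h2
    have h3 := real_Iic_eq_real_Iio_add (sqMeasure (π n) y) (l n u)
    have h4 := real_Iic_le_real_Iio μ hs
    linarith [h1.2, h2.1]
  · have hε' : 0 < ε / 5 := by positivity
    obtain ⟨v, w, hv, hw, hvw⟩ := hπ.exists_seq_mem_Ioc hu
    obtain ⟨a, ha, hau⟩ := (((tendsto_real_Iic_left μ u).eventually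
      (lt_mem_nhds (sub_lt_self _ hε'))).and self_mem_nhdsWithin).exists
    obtain ⟨b, hb, hub⟩ := ((((continuousWithinAt_real_Iic μ u).mono
      Ioi_subset_Ici_self).eventually
      (gt_mem_nhds (lt_add_of_pos_right _ hε'))).and self_mem_nhdsWithin).exists
    obtain ⟨a', haa', ha'u⟩ := exists_between (show a < u from hau)
    obtain ⟨n, h1, h2, h3, h4, h5⟩ := ((hcdf a a' haa' _ hε').and ((hcdf u b hub _ hε').and
      ((hv.eventually (lt_mem_nhds ha'u)).and (hvw.and
      (hy.eventually_lt_sqMeasure_singleton hv hw hvw hε'))))).exists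
    have h7 := real_Iic_eq_real_Iio_add (sqMeasure (π n) y) (v n)
    have h8 := real_Iic_le_real_Iio (sqMeasure (π n) y) h3
    have h9 := monotone_real_Iic (sqMeasure (π n) y) h4.1.le
    simp only at h9
    linarith [h1.2, h2.1]

lemma exists_measure_real_Iic_eq {F : ℝ≥0 → ℝ} (hmono : Monotone F)
    (hF : ∀ t, ContinuousWithinAt F (Ici t) t) (h0 : F 0 = 0) :
    ∃ μ : Measure ℝ≥0, IsFiniteMeasureOnCompacts μ ∧ F = fun t => μ.real (Iic t) := by
  let G : StieltjesFunction ℝ≥0 := ⟨F, hmono, hF⟩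
  refine ⟨G.measure, inferInstance, funext fun t => ?_⟩
  have h : Iic t = Icc 0 t := by ext; simp
  have hl : Function.leftLim G 0 = 0 := (leftLim_eq_of_isBot fun _ => zero_le).trans h0
  rw [h, Measure.real, G.measure_Icc, hl, sub_zero, ENNReal.toReal_ofReal]
  exact h0 ▸ hmono zero_le

lemma isFollmerQV_of_timeChanges (hπ : IsVanishing π) (hy : IsCadlag y) {F : ℝ≥0 → ℝ}
    (hF : IsCadlag F) {l : ℕ → (ℝ≥0 ≃o ℝ≥0)}
    (hl : TendstoUniformly (fun n s => l n s) (fun s => s) atTop)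
    (hunif : ∀ N, TendstoUniformlyOn (fun n s => (sqMeasure (π n) y).real (Iic (l n s))) F
      atTop (Iic N)) : IsFollmerQV π y F := by
  have hls : ∀ s, Tendsto (fun n => l n s) atTop (𝓝 s) := fun s => hl.tendsto_at s
  have hpt : ∀ s, Tendsto (fun n => (sqMeasure (π n) y).real (Iic (l n s))) atTop (𝓝 (F s)) :=
    fun s => (hunif s).tendsto_at (mem_Iic.2 le_rfl)
  have hmono : Monotone F := fun a b hab => le_of_tendsto_of_tendsto' (hpt a) (hpt b)
    fun n => monotone_real_Iic _ ((l n).monotone hab)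
  have h0 : F 0 = 0 := by
    refine le_antisymm (le_of_forall_pos_le_add fun ε hε => ?_)
      (ge_of_tendsto' (hpt 0) fun n => measureReal_nonneg)
    -- Time changes fix `0`, and the discrete mass there is the first squared increment, which
    -- vanishes in the limit by right-continuity.
    refine le_of_tendsto (hpt 0) ?_
    filter_upwards [hy.eventually_sqMeasure_singleton_lt hπ (hls 0) hε] with n hn
    have hz : l n 0 = 0 := map_bot (l n)
    rw [jump_zero, hz] at hn
    rw [hz, real_Iic_eq_real_Iio_add]
    simpa using hn.le
  obtain ⟨μ, hμ, rfl⟩ := exists_measure_real_Iic_eq hmono (fun t => (hF t).1) h0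
  have hcdf : CdfTendsto (fun n => sqMeasure (π n) y) μ := by
    intro a b hab ε hε
    filter_upwards [(hls a).eventually (gt_mem_nhds hab), (hls b).eventually (lt_mem_nhds hab),
      (hpt a).eventually (lt_mem_nhds (sub_lt_self _ hε)),
      (hpt b).eventually (gt_mem_nhds (lt_add_of_pos_right _ hε))] with n h1 h2 h3 h4
    exact ⟨(monotone_real_Iic (sqMeasure (π n) y) h2.le).trans_lt h4,
      h3.trans_le (monotone_real_Iic (sqMeasure (π n) y) h1.le)⟩
  refine isFollmerQV_of_cdfTendsto hcdf fun u => ?_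
  rcases eq_zero_or_pos u with rfl | hu
  · simp only [real_Iic_eq_real_Iio_add] at h0
    rw [jump_zero]
    simpa using h0
  · exact real_singleton_eq_sq_jump hπ hy hls hu hcdf (hunif u)

end Scalar

/-! ### Entrywise reduction for matrix-valued paths. -/

section Cadlag

variable {m : ℕ}

lemma IsCadlag.comp_continuous {E E' : Type*} [TopologicalSpace E] [TopologicalSpace E']
    {f : ℝ≥0 → E} (hf : IsCadlag f) {φ : E → E'} (hφ : Continuous φ) :
    IsCadlag fun t => φ (f t) := fun t =>
  ⟨hφ.continuousAt.comp_continuousWithinAt (hf t).1,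
    (hf t).2.imp' φ fun _ h => (hφ.tendsto _).comp h⟩

lemma isCadlag_matrix {Q : ℝ≥0 → Matrix (Fin m) (Fin m) ℝ}
    (h : ∀ i j, IsCadlag fun t => Q t i j) : IsCadlag Q := by
  refine fun t => ⟨continuousWithinAt_pi.2 fun i => continuousWithinAt_pi.2 fun j => (h i j t).1, ?_⟩
  choose L hL using fun i j => (h i j t).2
  exact ⟨L, tendsto_pi_nhds.2 fun i => tendsto_pi_nhds.2 fun j => hL i j⟩

lemma IsCadlag.sub {f g : ℝ≥0 → ℝ} (hf : IsCadlag f) (hg : IsCadlag g) :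
    IsCadlag fun t => f t - g t := fun t => by
  obtain ⟨a, ha⟩ := (hf t).2
  obtain ⟨b, hb⟩ := (hg t).2
  exact ⟨(hf t).1.sub (hg t).1, a - b, ha.sub hb⟩

lemma tendstoUniformlyOn_matrix_iff {α ι : Type*} {p : Filter ι} {s : Set α}
    {F : ι → α → Matrix (Fin m) (Fin m) ℝ} {f : α → Matrix (Fin m) (Fin m) ℝ} :
    TendstoUniformlyOn F f p s ↔
      ∀ i j, TendstoUniformlyOn (fun n a => F n a i j) (fun a => f a i j) p s := by
  simp only [tendstoUniformlyOn_iff_tendsto, Matrix.uniformity, tendsto_iInf, tendsto_comap_iff]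
  rfl

end Cadlag

/-! ### The two implications for vector-valued paths. -/

section Vector

variable {m : ℕ} {π : ℕ → TimePartition} {x : ℝ≥0 → Fin m → ℝ}
  {Q : ℝ≥0 → Matrix (Fin m) (Fin m) ℝ}

lemma IsVectorFollmerQV.isSkorokhodQV (hπ : IsVanishing π) (hx : IsCadlag x)
    (h : IsVectorFollmerQV π x Q) : IsSkorokhodQV π x Q := by
  obtain ⟨q, r, hq, hr, hQ⟩ := h
  -- All coordinates and pairwise sums form one finite family, so that a single sequence of time
  -- changes handles them together.
  let y : Fin m ⊕ Fin m × Fin m → ℝ≥0 → ℝ :=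
    Sum.elim (fun i t => x t i) fun p t => x t p.1 + x t p.2
  have hy : ∀ k, IsCadlag (y k) := by
    rintro (i | ⟨i, j⟩)
    · exact hx.comp_continuous (continuous_apply i)
    · exact hx.comp_continuous ((continuous_apply i).add (continuous_apply j))
  have hqr : ∀ k, IsFollmerQV π (y k) (Sum.elim q (fun p => r p.1 p.2) k) := by
    rintro (i | ⟨i, j⟩)
    · exact hq i
    · exact hr i j
  choose μ hμ hcdf hjump hqμ using fun k => (hqr k).exists_measure
  obtain ⟨l, hl, hunif⟩ := exists_timeChanges hπ hy hcdf hjump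
  have hq' : ∀ i, q i = fun t => (μ (Sum.inl i)).real (Iic t) := fun i => hqμ (Sum.inl i)
  have hr' : ∀ i j, r i j = fun t => (μ (Sum.inr (i, j))).real (Iic t) :=
    fun i j => hqμ (Sum.inr (i, j))
  refine ⟨isCadlag_matrix fun i j => ?_, l, hl, fun N =>
    tendstoUniformlyOn_matrix_iff.2 fun i j => ?_⟩
  · simp only [hQ, hq', hr']
    exact (((isCadlag_real_Iic _).sub (isCadlag_real_Iic _)).sub
      (isCadlag_real_Iic _)).comp_continuous (continuous_id.div_const 2)
  · have hsum : ∀ n s, matrixSum (π n) x s i j = 2⁻¹ *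
        ((sqMeasure (π n) (y (Sum.inr (i, j)))).real (Iic s) -
          (sqMeasure (π n) (y (Sum.inl i))).real (Iic s) -
          (sqMeasure (π n) (y (Sum.inl j))).real (Iic s)) := fun n s => by
      simp only [y, Sum.elim_inl, Sum.elim_inr, sqMeasure_real_Iic_coord, sqMeasure_real_Iic_add]
      ring
    simp only [hsum, hQ, hq', hr', div_eq_inv_mul]
    exact (Real.uniformContinuous_const_mul (x := 2⁻¹)).comp_tendstoUniformlyOn
      (((hunif (Sum.inr (i, j)) N).sub (hunif (Sum.inl i) N)).sub (hunif (Sum.inl j) N))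

lemma IsSkorokhodQV.isVectorFollmerQV (hπ : IsVanishing π) (hx : IsCadlag x)
    (h : IsSkorokhodQV π x Q) : IsVectorFollmerQV π x Q := by
  obtain ⟨hQ, l, hl, hunif⟩ := h
  have hentry : ∀ i j, Continuous fun M : Matrix (Fin m) (Fin m) ℝ => M i j := fun i j =>
    continuous_id.matrix_elem i j
  have hunif' := fun N => tendstoUniformlyOn_matrix_iff.1 (hunif N)
  -- Polarization read backwards: `[x^i + x^j]` must be `Q i i + Q j j + 2 * Q i j`, the limit of
  -- the identity `sqMeasure_real_Iic_add`.
  refine ⟨fun i t => Q t i i, fun i j t => Q t i i + Q t j j + 2 * Q t i j, fun i => ?_,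
    fun i j => ?_, fun t i j => by ring⟩
  · refine isFollmerQV_of_timeChanges hπ (hx.comp_continuous (continuous_apply i))
      (hQ.comp_continuous (hentry i i)) hl fun N => ?_
    simp only [sqMeasure_real_Iic_coord]
    exact hunif' N i i
  · have hxy : IsCadlag fun t => x t i + x t j :=
      hx.comp_continuous ((continuous_apply i).add (continuous_apply j))
    refine isFollmerQV_of_timeChanges hπ hxy
      (hQ.comp_continuous (((hentry i i).add (hentry j j)).add ((hentry i j).const_mul 2)))
      hl fun N => ?_
    simp only [sqMeasure_real_Iic_add]
    exact ((hunif' N i i).add (hunif' N j j)).add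
      ((Real.uniformContinuous_const_mul (x := 2)).comp_tendstoUniformlyOn (hunif' N i j))

lemma hasVectorFollmerQV_iff : HasVectorFollmerQV π x ↔ ∃ Q, IsVectorFollmerQV π x Q := by
  constructor
  · rintro ⟨hq, hr⟩
    choose q hq using hq
    choose r hr using hr
    exact ⟨fun t => Matrix.of fun i j => (r i j t - q i t - q j t) / 2, q, r, hq, hr,
      fun _ _ _ => rfl⟩
  · rintro ⟨Q, q, r, hq, hr, -⟩
    exact ⟨fun i => ⟨q i, hq i⟩, fun i j => ⟨r i j, hr i j⟩⟩

end Vector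

end PathwiseQV

theorem theorem3p6 (m : ℕ) (π : ℕ → TimePartition) (hπ : IsVanishing π)
    (x : ℝ≥0 → Fin m → ℝ) (hx : IsCadlag x) :
    (HasVectorFollmerQV π x ↔ HasSkorokhodQV π x) ∧
      ∀ Q : ℝ≥0 → Matrix (Fin m) (Fin m) ℝ,
        IsVectorFollmerQV π x Q ↔ IsSkorokhodQV π x Q := by
  have h : ∀ Q : ℝ≥0 → Matrix (Fin m) (Fin m) ℝ,
      IsVectorFollmerQV π x Q ↔ IsSkorokhodQV π x Q := fun Q =>
    ⟨fun h => h.isSkorokhodQV hπ hx, fun h => h.isVectorFollmerQV hπ hx⟩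
  exact ⟨hasVectorFollmerQV_iff.trans (exists_congr h), h⟩
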